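/- **Setting.** Let $m\ge 0$, $a\in\mathbb R$, and put $q=r+ia\cos\theta$, $|q|^2=r^2+a^2\cos^2\theta$, $\Delta=r^2-2mr+a^2$, $\Sigma^2=(r^2+a^2)|q|^2+2mra^2\sin^2\theta$. Consider the Kerr metric in Boyer–Lindquist coordinates $(t,r,\theta,\varphi)$, $$\mathbf g=-\frac{|q|^2\Delta}{\Sigma^2}dt^2+\frac{\Sigma^2\sin^2\theta}{|q|^2}\Big(d\varphi-\frac{2amr}{\Sigma^2}dt\Big)^2+\frac{|q|^2}{\Delta}dr^2+|q|^2d\theta^2,$$ on an open set $U$ of coordinate values with $r>0$, $\Delta\ne0$, $0<\theta<\pi$, with Levi-Civita connection $\mathbf D$, scalar wave operator $\square_{\mathbf g}=\mathbf g^{\mu\nu}\mathbf D_\mu\mathbf D_\nu$ and curvature $\mathbf R(W,Z,X,Y)=\mathbf g(W,\mathbf D_X\mathbf D_YZ-\mathbf D_Y\mathbf D_XZ-\mathbf D_{[X,Y]}Z)$, and the principal null frame $$e_4=\tfrac{r^2+a^2}{\Delta}\partial_t+\partial_r+\tfrac a\Delta\partial_\varphi,\quad e_3=\tfrac{r^2+a^2}{|q|^2}\partial_t-\tfrac{\Delta}{|q|^2}\partial_r+\tfrac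 a{|q|^2}\partial_\varphi,\quad e_1=\tfrac1{|q|}\partial_\theta,\quad e_2=\tfrac{a\sin\theta}{|q|}\partial_t+\tfrac1{|q|\sin\theta}\partial_\varphi .$$ Indices $b,c,d$ run over $\{1,2\}$, repeated ones are summed, and $\in_{12}=-\in_{21}=1$, $\in_{11}=\in_{22}=0$. Let $$\chi_{bc}=\mathbf g(\mathbf D_be_4,e_c),\quad \underline\chi_{bc}=\mathbf g(\mathbf D_be_3,e_c),\quad \mathrm{tr}\chi=\chi_{bb},\quad {}^{(a)}\mathrm{tr}\chi=\in_{bc}\chi_{bc},\quad\mathrm{tr}\underline\chi=\underline\chi_{bb},\quad {}^{(a)}\mathrm{tr}\underline\chi=\in_{bc}\underline\chi_{bc},$$ $$\eta_b=\tfrac12\mathbf g(\mathbf D_3e_4,e_b),\quad\underline\eta_b=\tfrac12\mathbf g(\mathbf D_4e_3,e_b),\quad\zeta_b=\tfrac12\mathbf g(\mathbf D_be_4,e_3),\quad\omega=\tfrac14\mathbf g(\mathbf D_4e_4,e_3),\quad\underline\omega=\tfrac14\mathbf g(\mathbf D_3e_3,e_4),$$ $$\rho=\tfrac14\mathbf R(e_4,e_3,e_4,e_3),\qquad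 {}^*\rho=\tfrac12\mathbf R(e_1,e_2,e_3,e_4),\qquad P=\rho+i\,{}^*\rho,\qquad\Lambda=\tfrac{r^2+a^2}{|q|^3}\cot\theta,$$ $\mathrm{tr}X=\mathrm{tr}\chi-i\,{}^{(a)}\mathrm{tr}\chi$, $\mathrm{tr}\underline X=\mathrm{tr}\underline\chi-i\,{}^{(a)}\mathrm{tr}\underline\chi$, $H=\eta+i\,{}^*\eta$, $\underline H=\underline\eta+i\,{}^*\underline\eta$, with $({}^*\xi)_b=\in_{bc}\xi_c$. Let $\nabla_X$ be the horizontal covariant derivative on horizontal tensors (from $\nabla_Xe_b=\sum_c\mathbf g(\mathbf D_Xe_b,e_c)e_c$ and the Leibniz rule), and for a horizontal tensor of conformal type $s$ put ${}^{(c)}\nabla_3=\nabla_3-2s\underline\omega$ (result of type $s-1$), ${}^{(c)}\nabla_4=\nabla_4+2s\omega$ (result of type $s+1$), ${}^{(c)}\nabla_b=\nabla_b+s\zeta_b$, ${}^{(c)}\mathcal D_b={}^{(c)}\nabla_b+i\in_{bc}{}^{(c)}\nabla_c$, $\overline{{}^{(c)}\mathcal D}_b={}^{(c)}\nabla_b-i\in_{bc}{}^{(c)}\nabla_c$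 (both of type $s$). Let $(\xi\cdot U)_b=\xi_cU_{cb}$ and $(\xi\widehat\otimes\eta)_{bc}=\frac12(\xi_b\eta_c+\xi_c\eta_b-\delta_{bc}\,\xi\cdot\eta)$. Let $A\in\mathcal S_2(\mathbb C)$ be a complex horizontal 2-tensor on $U$ of class $C^2$ and of conformal type $2$, anti-self dual in the sense that $A=u+i\,{}^*u$ with $u$ real, symmetric, traceless and $({}^*u)_{bc}=\in_{bd}u_{dc}$. The tensorial Teukolsky operator is $$\begin{aligned}\mathcal L(A)=&-{}^{(c)}\nabla_4{}^{(c)}\nabla_3A+\tfrac12{}^{(c)}\mathcal D\widehat\otimes(\overline{{}^{(c)}\mathcal D}\cdot A)+\big(-\tfrac12\mathrm{tr}X-2\overline{\mathrm{tr}X}\big){}^{(c)}\nabla_3A-\tfrac12\mathrm{tr}\underline X\,{}^{(c)}\nabla_4A\\&+(4H+\underline H+\overline{\underline H})\cdot{}^{(c)}\nabla A+\big(-\overline{\mathrm{tr}X}\,\mathrm{tr}\underline X+2\overline P\big)A+2H\widehat\otimes(\overline{\underline H}\cdot A).\end{aligned}$$ **Statement.** Let $\mathfrak a=A_{11}=A(e_1,e_1)$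 and consider the scalar equation $$\square_{\mathbf g}\mathfrak a=\big(-4\underline\omega+i\,{}^{(a)}\mathrm{tr}\underline\chi\big)e_4(\mathfrak a)+\big(2\,\mathrm{tr}\chi+3i\,{}^{(a)}\mathrm{tr}\chi\big)e_3(\mathfrak a)+4i\underline\eta_2e_1(\mathfrak a)+\big(8\underline\eta_2-4i(\Lambda-\underline\eta_1)\big)e_2(\mathfrak a)+V\mathfrak a\qquad(\star)$$ with $$\begin{aligned}V=\;&4\Lambda^2+\tfrac12\mathrm{tr}\chi\,\mathrm{tr}\underline\chi-\tfrac52{}^{(a)}\mathrm{tr}\chi\,{}^{(a)}\mathrm{tr}\underline\chi-10\underline\omega\,\mathrm{tr}\chi-8\rho+2e_1(\underline\eta_1)-6\Lambda\underline\eta_1+8\underline\eta_1^2-16\underline\eta_2^2\\&+i\big({}^{(a)}\mathrm{tr}\chi\,\mathrm{tr}\underline\chi+{}^{(a)}\mathrm{tr}\underline\chi\,\mathrm{tr}\chi-10\underline\omega\,{}^{(a)}\mathrm{tr}\chi+4\,{}^*\rho+12\Lambda\underline\eta_2-8\underline\eta_1\underline\eta_2\big).\end{aligned}$$ 1. On $U$,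 $\mathcal L(A)_{11}$ equals the left-hand side minus the right-hand side of $(\star)$. Moreover $\mathcal L(A)=0$ on $U$ if and only if $\mathfrak a$ satisfies $(\star)$ on $U$. 2. At each point of $U$, $\mathfrak a$ satisfies $(\star)$ if and only if $\alpha^{[+2]}=-\frac{\overline q}{q}\mathfrak a$ satisfies the classical Teukolsky equation $$\begin{aligned}|q|^2\square_{\mathbf g}\alpha^{[+2]}=&-4(r-m)\partial_r\alpha^{[+2]}-4\Big(\frac{m(r^2-a^2)}\Delta-r-ia\cos\theta\Big)\partial_t\alpha^{[+2]}\\&-4\Big(\frac{a(r-m)}\Delta+i\frac{\cos\theta}{\sin^2\theta}\Big)\partial_\varphi\alpha^{[+2]}+(4\cot^2\theta-2)\alpha^{[+2]}.\end{aligned}$$ 3. The relation $\alpha^{[+2]}=-\frac{\overline q}{q}\mathfrak a$ is the one between the Newman–Penrose and the tensorial components of a Weyl tensor: if $W$ is a Weyl tensor at a point of $U$ (curvature symmetries, trace free), $\alpha_{bc}=W(e_4,e_b,e_4,e_c)$, $A(W)=\alpha+i\,{}^*\alpha$ and $n=\frac{|q|}{\sqrt2\,q}(e_1+ie_2)$,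 then $-W(e_4,n,e_4,n)=-\frac{\overline q}{q}A(W)_{11}$. -/

import Mathlib

noncomputable section

namespace KerrTeukolsky

/-! ### Tensor calculus in a coordinate chart of a four-dimensional space-time -/

/-- Points of a coordinate chart. For Boyer–Lindquist coordinates
`x 0 = t`, `x 1 = r`, `x 2 = θ`, `x 3 = φ`. -/
abbrev Pt := Fin 4 → ℝ

/-- Vector fields, by their coordinate components `X x μ = X^μ(x)`. -/
abbrev VF := Pt → Fin 4 → ℝ

/-- Metrics, by their coordinate components `g x μ ν = g_{μν}(x)`. -/
abbrev Metric := Pt → Matrix (Fin 4) (Fin 4) ℝ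

/-- The coordinate derivative `∂_μ f`. -/
def pd {F : Type*} [NormedAddCommGroup F] [NormedSpace ℝ F]
    (μ : Fin 4) (f : Pt → F) (x : Pt) : F :=
  fderiv ℝ f x (Pi.single μ 1)

/-- The derivative `X(f) = X^μ ∂_μ f` of a function along a vector field. -/
def along {F : Type*} [NormedAddCommGroup F] [NormedSpace ℝ F]
    (X : VF) (f : Pt → F) (x : Pt) : F :=
  ∑ μ, X x μ • pd μ f x

/-- `g(X, Y)`. -/
def ip (g : Metric) (X Y : VF) (x : Pt) : ℝ :=
  ∑ μ, ∑ ν, g x μ ν * X x μ * Y x ν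

/-- The Christoffel symbols `Γ^l_{μν}` of the Levi-Civita connection of `g`. -/
def christoffel (g : Metric) (l μ ν : Fin 4) (x : Pt) : ℝ :=
  (1 / 2) * ∑ k, (g x)⁻¹ l k *
    (pd μ (fun y => g y k ν) x + pd ν (fun y => g y k μ) x - pd k (fun y => g y μ ν) x)

/-- The Levi-Civita covariant derivative `D_X Y`. -/
def covD (g : Metric) (X Y : VF) : VF := fun x l =>
  along X (fun y => Y y l) x + ∑ μ, ∑ ν, christoffel g l μ ν x * X x μ * Y x ν

/-- The commutator `[X, Y]`. -/
def bracket (X Y : VF) : VF := fun x l =>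
  along X (fun y => Y y l) x - along Y (fun y => X y l) x

/-- The curvature `R(W, Z, X, Y) = g(W, D_X D_Y Z - D_Y D_X Z - D_[X,Y] Z)`. -/
def riem (g : Metric) (W Z X Y : VF) (x : Pt) : ℝ :=
  ip g W (fun y l => covD g X (covD g Y Z) y l - covD g Y (covD g X Z) y l
    - covD g (bracket X Y) Z y l) x

/-- The scalar wave operator `□_g f = g^{μν} (∂_μ ∂_ν f - Γ^l_{μν} ∂_l f)`. -/
def box (g : Metric) (f : Pt → ℂ) (x : Pt) : ℂ :=
  ∑ μ, ∑ ν, (((g x)⁻¹ μ ν : ℝ) : ℂ) *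
    (pd μ (fun y => pd ν f y) x - ∑ l, ((christoffel g l μ ν x : ℝ) : ℂ) * pd l f x)

/-! ### The horizontal structure of a null frame

A null frame is `e : Fin 4 → VF` with `e 0 = e_1`, `e 1 = e_2`, `e 2 = e_3`, `e 3 = e_4`, where
`(e_3, e_4)` is a null pair with `g(e_3, e_4) = -2` and `(e_1, e_2)` is an orthonormal, positively
oriented basis of the orthogonal complement (the horizontal space).  A horizontal covariant
tensor is given by its components relative to `(e_1, e_2)`. -/

/-- The inclusion of horizontal frame indices in frame indices. -/
def hz : Fin 2 → Fin 4 := ![0, 1]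

/-- The horizontal volume form `∈_{ab}`, with `∈_{12} = 1`. -/
def eps : Fin 2 → Fin 2 → ℝ := ![![0, 1], ![-1, 0]]

/-- Complex horizontal 1-forms. -/
abbrev HForm := Pt → Fin 2 → ℂ

/-- Complex horizontal covariant 2-tensors. -/
abbrev HTensor := Pt → Fin 2 → Fin 2 → ℂ

section Frame

variable (g : Metric) (e : Fin 4 → VF)

/-- `χ_{ab} = g(D_a e_4, e_b)`. -/
def chi (a b : Fin 2) (x : Pt) : ℝ := ip g (covD g (e (hz a)) (e 3)) (e (hz b)) x

/-- `χ̲_{ab} = g(D_a e_3, e_b)`. -/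
def chib (a b : Fin 2) (x : Pt) : ℝ := ip g (covD g (e (hz a)) (e 2)) (e (hz b)) x

/-- `tr χ = δ^{ab} χ_{ab}`. -/
def trChi (x : Pt) : ℝ := ∑ a, chi g e a a x

/-- `⁽ᵃ⁾tr χ = ∈^{ab} χ_{ab}`. -/
def atrChi (x : Pt) : ℝ := ∑ a, ∑ b, eps a b * chi g e a b x

/-- `tr χ̲ = δ^{ab} χ̲_{ab}`. -/
def trChib (x : Pt) : ℝ := ∑ a, chib g e a a x

/-- `⁽ᵃ⁾tr χ̲ = ∈^{ab} χ̲_{ab}`. -/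
def atrChib (x : Pt) : ℝ := ∑ a, ∑ b, eps a b * chib g e a b x

/-- `η_a = ½ g(D_3 e_4, e_a)`. -/
def eta (a : Fin 2) (x : Pt) : ℝ := (1 / 2) * ip g (covD g (e 2) (e 3)) (e (hz a)) x

/-- `η̲_a = ½ g(D_4 e_3, e_a)`. -/
def etab (a : Fin 2) (x : Pt) : ℝ := (1 / 2) * ip g (covD g (e 3) (e 2)) (e (hz a)) x

/-- `ζ_a = ½ g(D_a e_4, e_3)`. -/
def zeta (a : Fin 2) (x : Pt) : ℝ := (1 / 2) * ip g (covD g (e (hz a)) (e 3)) (e 2) x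

/-- `ω = ¼ g(D_4 e_4, e_3)`. -/
def om (x : Pt) : ℝ := (1 / 4) * ip g (covD g (e 3) (e 3)) (e 2) x

/-- `ω̲ = ¼ g(D_3 e_3, e_4)`. -/
def omb (x : Pt) : ℝ := (1 / 4) * ip g (covD g (e 2) (e 2)) (e 3) x

/-- `ρ = ¼ R(e_4, e_3, e_4, e_3)`. -/
def rho (x : Pt) : ℝ := (1 / 4) * riem g (e 3) (e 2) (e 3) (e 2) x

/-- `*ρ = ¼ *R(e_4, e_3, e_4, e_3)`, where `*R_{αβμν} = ½ ∈_{μν}^{ρσ} R_{αβρσ}`.  Since the volume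
form satisfies `½ ∈(e_1, e_2, e_3, e_4) = ∈_{12} = 1` and `g(e_3, e_4) = -2`, this is
`½ R(e_1, e_2, e_3, e_4)`. -/
def rhoDual (x : Pt) : ℝ := (1 / 2) * riem g (e 0) (e 1) (e 2) (e 3) x

/-- `tr X = tr χ - i ⁽ᵃ⁾tr χ`. -/
def trX (x : Pt) : ℂ := (trChi g e x : ℂ) - Complex.I * (atrChi g e x : ℂ)

/-- `tr X̲ = tr χ̲ - i ⁽ᵃ⁾tr χ̲`. -/
def trXb (x : Pt) : ℂ := (trChib g e x : ℂ) - Complex.I * (atrChib g e x : ℂ)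

/-- `P = ρ + i *ρ`. -/
def curvP (x : Pt) : ℂ := (rho g e x : ℂ) + Complex.I * (rhoDual g e x : ℂ)

/-- `H = η + i *η`, where `(*η)_a = ∈_{ab} η_b`. -/
def bigH : HForm := fun x a =>
  (eta g e a x : ℂ) + Complex.I * ∑ b, (eps a b : ℂ) * (eta g e b x : ℂ)

/-- `H̲ = η̲ + i *η̲`. -/
def bigHb : HForm := fun x a =>
  (etab g e a x : ℂ) + Complex.I * ∑ b, (eps a b : ℂ) * (etab g e b x : ℂ)

/-- The coefficients `g(D_X e_a, e_b)` of the horizontal connection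
`∇_X e_a = (D_X e_a)^⊥ = ∑_b g(D_X e_a, e_b) e_b`. -/
def hconn (X : VF) (a b : Fin 2) (x : Pt) : ℝ := ip g (covD g X (e (hz a))) (e (hz b)) x

/-- The horizontal covariant derivative of 1-forms,
`(∇_X F)(e_a) = X(F(e_a)) - F(∇_X e_a)`. -/
def nabla1 (X : VF) (F : HForm) : HForm := fun x a =>
  along X (fun y => F y a) x - ∑ c, (hconn g e X a c x : ℂ) * F x c

/-- The horizontal covariant derivative of 2-tensors,
`(∇_X U)(e_a, e_b) = X(U(e_a, e_b)) - U(∇_X e_a, e_b) - U(e_a, ∇_X e_b)`. -/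
def nabla2 (X : VF) (U : HTensor) : HTensor := fun x a b =>
  along X (fun y => U y a b) x - ∑ c, (hconn g e X a c x : ℂ) * U x c b
    - ∑ c, (hconn g e X b c x : ℂ) * U x a c

/-- The conformal derivative `⁽ᶜ⁾∇_3 U = ∇_3 U - 2 s ω̲ U` of a 2-tensor of conformal type `s`
(the result is of conformal type `s - 1`). -/
def cNabla3 (s : ℝ) (U : HTensor) : HTensor := fun x a b =>
  nabla2 g e (e 2) U x a b - 2 * (s : ℂ) * (omb g e x : ℂ) * U x a b

/-- The conformal derivative `⁽ᶜ⁾∇_4 U = ∇_4 U + 2 s ω U` of a 2-tensor of conformal type `s`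
(the result is of conformal type `s + 1`). -/
def cNabla4 (s : ℝ) (U : HTensor) : HTensor := fun x a b =>
  nabla2 g e (e 3) U x a b + 2 * (s : ℂ) * (om g e x : ℂ) * U x a b

/-- The conformal derivative `⁽ᶜ⁾∇_c F = ∇_c F + s ζ_c F` of a 1-form of conformal type `s`
(the result is of conformal type `s`). -/
def cNablaH1 (s : ℝ) (c : Fin 2) (F : HForm) : HForm := fun x a =>
  nabla1 g e (e (hz c)) F x a + (s : ℂ) * (zeta g e c x : ℂ) * F x a

/-- The conformal derivative `⁽ᶜ⁾∇_c U = ∇_c U + s ζ_c U` of a 2-tensor of conformal type `s`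
(the result is of conformal type `s`). -/
def cNablaH2 (s : ℝ) (c : Fin 2) (U : HTensor) : HTensor := fun x a b =>
  nabla2 g e (e (hz c)) U x a b + (s : ℂ) * (zeta g e c x : ℂ) * U x a b

/-- The complex derivative `⁽ᶜ⁾𝒟_a F_b = (⁽ᶜ⁾∇ + i *⁽ᶜ⁾∇)_a F_b` of a 1-form. -/
def cD1 (s : ℝ) (F : HForm) : HTensor := fun x a b =>
  cNablaH1 g e s a F x b + Complex.I * ∑ c, (eps a c : ℂ) * cNablaH1 g e s c F x b

/-- `⁽ᶜ⁾𝒟 ⊗̂ F`, with the normalisation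
`(ξ ⊗̂ η)_{ab} = ½ (ξ_a η_b + ξ_b η_a - δ_{ab} ξ·η)`. -/
def cDHat (s : ℝ) (F : HForm) : HTensor := fun x a b =>
  (1 / 2) * (cD1 g e s F x a b + cD1 g e s F x b a
    - (if a = b then ∑ c, cD1 g e s F x c c else 0))

/-- The divergence `(⁽ᶜ⁾𝒟̄ · U)_a = δ^{bc} (⁽ᶜ⁾∇ - i *⁽ᶜ⁾∇)_b U_{ca}` of a 2-tensor. -/
def cDbarDiv (s : ℝ) (U : HTensor) : HForm := fun x a =>
  ∑ b, (cNablaH2 g e s b U x b a - Complex.I * ∑ c, (eps b c : ℂ) * cNablaH2 g e s c U x b a)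

/-- `2 H ⊗̂ (H̲̄ · U)`, where `(ξ · U)_a = ξ_b U_{ab}`. -/
def HHbU (U : HTensor) : HTensor := fun x a b =>
  let v : Fin 2 → ℂ := fun c => ∑ d, (starRingEnd ℂ) (bigHb g e x d) * U x c d
  2 * ((1 / 2) * (bigH g e x a * v b + bigH g e x b * v a
    - (if a = b then ∑ c, bigH g e x c * v c else 0)))

/-- The tensorial Teukolsky operator, for `A` of conformal type `2`:
`ℒ(A) = -⁽ᶜ⁾∇_4 ⁽ᶜ⁾∇_3 A + ½ ⁽ᶜ⁾𝒟 ⊗̂ (⁽ᶜ⁾𝒟̄ · A) + (-½ tr X - 2 tr X̄) ⁽ᶜ⁾∇_3 A - ½ tr X̲ ⁽ᶜ⁾∇_4 A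
  + (4H + H̲ + H̲̄) · ⁽ᶜ⁾∇ A + (-tr X̄ tr X̲ + 2 P̄) A + 2 H ⊗̂ (H̲̄ · A)`. -/
def teukolskyOp (A : HTensor) : HTensor := fun x a b =>
  - cNabla4 g e 1 (cNabla3 g e 2 A) x a b
  + (1 / 2) * cDHat g e 2 (cDbarDiv g e 2 A) x a b
  + (-(1 / 2) * trX g e x - 2 * (starRingEnd ℂ) (trX g e x)) * cNabla3 g e 2 A x a b
  - (1 / 2) * trXb g e x * cNabla4 g e 2 A x a b
  + ∑ c, (4 * bigH g e x c + bigHb g e x c + (starRingEnd ℂ) (bigHb g e x c))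
      * cNablaH2 g e 2 c A x a b
  + (-((starRingEnd ℂ) (trX g e x)) * trXb g e x + 2 * (starRingEnd ℂ) (curvP g e x)) * A x a b
  + HHbU g e A x a b

end Frame

/-- Membership in `𝒮_2(ℂ)` at a point: `U = u + i *u` with `u` a real symmetric traceless
horizontal 2-tensor and `(*u)_{ab} = ∈_{ac} u_{cb}`. -/
def IsAntiSelfDual (U : Fin 2 → Fin 2 → ℂ) : Prop :=
  ∃ u : Fin 2 → Fin 2 → ℝ, (∀ a b, u a b = u b a) ∧ ∑ a, u a a = 0 ∧
    ∀ a b, U a b = (u a b : ℂ) + Complex.I * ∑ c, (eps a c : ℂ) * (u c b : ℂ)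

/-- Weyl tensors at a point where the metric is `g`: covariant 4-tensors with the symmetries of
the curvature tensor and vanishing traces. -/
structure IsWeyl (g : Matrix (Fin 4) (Fin 4) ℝ) (W : Fin 4 → Fin 4 → Fin 4 → Fin 4 → ℝ) :
    Prop where
  antisymm_left : ∀ α β μ ν, W α β μ ν = -W β α μ ν
  antisymm_right : ∀ α β μ ν, W α β μ ν = -W α β ν μ
  pair_symm : ∀ α β μ ν, W α β μ ν = W μ ν α β
  cyclic : ∀ α β μ ν, W α β μ ν + W α μ ν β + W α ν β μ = 0
  trace_free : ∀ α μ, ∑ β, ∑ ν, g⁻¹ β ν * W α β μ ν = 0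

/-- The complex-multilinear evaluation `W(X, Y, Z, T)` on complex tangent vectors. -/
def evalC (W : Fin 4 → Fin 4 → Fin 4 → Fin 4 → ℝ) (X Y Z T : Fin 4 → ℂ) : ℂ :=
  ∑ α, ∑ β, ∑ μ, ∑ ν, (W α β μ ν : ℂ) * X α * Y β * Z μ * T ν

/-- A real vector regarded as a complex one. -/
def toC (X : Fin 4 → ℝ) : Fin 4 → ℂ := fun μ => (X μ : ℂ)

/-- The null component `A(W) = α + i *α`, where `α_{ab} = W(e_4, e_a, e_4, e_b)`, at the point `x`. -/
def nullA (e : Fin 4 → VF) (W : Fin 4 → Fin 4 → Fin 4 → Fin 4 → ℝ) (x : Pt) :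
    Fin 2 → Fin 2 → ℂ := fun a b =>
  let al : Fin 2 → Fin 2 → ℂ := fun c d =>
    evalC W (toC (e 3 x)) (toC (e (hz c) x)) (toC (e 3 x)) (toC (e (hz d) x))
  al a b + Complex.I * ∑ c, (eps a c : ℂ) * al c b

/-! ### The Kerr metric and its principal null frame in Boyer–Lindquist coordinates -/

section Kerr

variable (m a : ℝ)

/-- `q = r + i a cos θ`. -/
def q (x : Pt) : ℂ := (x 1 : ℂ) + Complex.I * ((a * Real.cos (x 2) : ℝ) : ℂ)

/-- `Δ = r² - 2 m r + a²`. -/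
def Del (x : Pt) : ℝ := x 1 ^ 2 - 2 * m * x 1 + a ^ 2

/-- `|q|² = r² + a² cos² θ`. -/
def qSq (x : Pt) : ℝ := x 1 ^ 2 + a ^ 2 * Real.cos (x 2) ^ 2

/-- `|q|`. -/
def qAbs (x : Pt) : ℝ := √(qSq a x)

/-- `Σ² = (r² + a²) |q|² + 2 m r a² sin² θ`. -/
def SigSq (x : Pt) : ℝ :=
  (x 1 ^ 2 + a ^ 2) * qSq a x + 2 * m * x 1 * a ^ 2 * Real.sin (x 2) ^ 2

/-- The set of Boyer–Lindquist coordinate values at which the coordinates, the metric and the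
null frame are regular: `r > 0`, `Δ ≠ 0`, `0 < θ < π`. It contains the whole exterior region of the
Kerr space-time minus the axis. -/
def patch : Set Pt := {x | 0 < x 1 ∧ Del m a x ≠ 0 ∧ 0 < x 2 ∧ x 2 < Real.pi}

/-- The Kerr metric
`g = -(|q|²Δ/Σ²) dt² + (Σ² sin²θ/|q|²) (dφ - (2amr/Σ²) dt)² + (|q|²/Δ) dr² + |q|² dθ²`. -/
def kerr : Metric := fun x =>
  let k := SigSq m a x * Real.sin (x 2) ^ 2 / qSq a x
  let w := 2 * a * m * x 1 / SigSq m a x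
  !![-(qSq a x * Del m a x / SigSq m a x) + k * w ^ 2, 0, 0, -(k * w);
     0, qSq a x / Del m a x, 0, 0;
     0, 0, qSq a x, 0;
     -(k * w), 0, 0, k]

/-- The principal null frame `(e_1, e_2, e_3, e_4)`:
`e_1 = |q|⁻¹ ∂_θ`, `e_2 = (a sin θ/|q|) ∂_t + (|q| sin θ)⁻¹ ∂_φ`,
`e_3 = ((r² + a²)/|q|²) ∂_t - (Δ/|q|²) ∂_r + (a/|q|²) ∂_φ`,
`e_4 = ((r² + a²)/Δ) ∂_t + ∂_r + (a/Δ) ∂_φ`. -/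
def frame : Fin 4 → VF :=
  ![fun x => ![0, 0, 1 / qAbs a x, 0],
    fun x => ![a * Real.sin (x 2) / qAbs a x, 0, 0, 1 / (qAbs a x * Real.sin (x 2))],
    fun x => ![(x 1 ^ 2 + a ^ 2) / qSq a x, -(Del m a x / qSq a x), 0, a / qSq a x],
    fun x => ![(x 1 ^ 2 + a ^ 2) / Del m a x, 1, 0, a / Del m a x]]

/-- `Λ = ((r² + a²)/|q|³) cot θ`. -/
def Lam (x : Pt) : ℝ := (x 1 ^ 2 + a ^ 2) / qAbs a x ^ 3 * Real.cot (x 2)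

/-- The real part of the potential,
`4Λ² + ½ trχ trχ̲ - (5/2) ⁽ᵃ⁾trχ ⁽ᵃ⁾trχ̲ - 10 ω̲ trχ - 8ρ + 2 e_1(η̲_1) - 6 Λ η̲_1 + 8 η̲_1² - 16 η̲_2²`. -/
def potRe (x : Pt) : ℝ :=
  let g := kerr m a
  let e := frame m a
  4 * Lam a x ^ 2 + (1 / 2) * trChi g e x * trChib g e x - (5 / 2) * atrChi g e x * atrChib g e x
    - 10 * omb g e x * trChi g e x - 8 * rho g e x + 2 * along (e 0) (etab g e 0) x
    - 6 * Lam a x * etab g e 0 x + 8 * etab g e 0 x ^ 2 - 16 * etab g e 1 x ^ 2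

/-- The imaginary part of the potential,
`⁽ᵃ⁾trχ trχ̲ + ⁽ᵃ⁾trχ̲ trχ - 10 ω̲ ⁽ᵃ⁾trχ + 4 *ρ + 12 Λ η̲_2 - 8 η̲_1 η̲_2`. -/
def potIm (x : Pt) : ℝ :=
  let g := kerr m a
  let e := frame m a
  atrChi g e x * trChib g e x + atrChib g e x * trChi g e x - 10 * omb g e x * atrChi g e x
    + 4 * rhoDual g e x + 12 * Lam a x * etab g e 1 x - 8 * etab g e 0 x * etab g e 1 x

/-- The potential `V`. -/
def potV (x : Pt) : ℂ := (potRe m a x : ℂ) + Complex.I * (potIm m a x : ℂ)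

/-- The right-hand side of the scalar wave equation,
`(-4ω̲ + i ⁽ᵃ⁾trχ̲) e_4(f) + (2 trχ + 3i ⁽ᵃ⁾trχ) e_3(f) + 4i η̲_2 e_1(f)
  + (8η̲_2 - 4i(Λ - η̲_1)) e_2(f) + V f`. -/
def waveRHS (f : Pt → ℂ) (x : Pt) : ℂ :=
  let g := kerr m a
  let e := frame m a
  (-4 * (omb g e x : ℂ) + Complex.I * (atrChib g e x : ℂ)) * along (e 3) f x
    + (2 * (trChi g e x : ℂ) + 3 * Complex.I * (atrChi g e x : ℂ)) * along (e 2) f x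
    + 4 * Complex.I * (etab g e 1 x : ℂ) * along (e 0) f x
    + (8 * (etab g e 1 x : ℂ) - 4 * Complex.I * ((Lam a x : ℂ) - (etab g e 0 x : ℂ)))
        * along (e 1) f x
    + potV m a x * f x

/-- The right-hand side of the classical Teukolsky equation of spin `+2` for `|q|² □_g f`,
`-4(r-m) ∂_r f - 4(m(r²-a²)/Δ - r - i a cos θ) ∂_t f - 4(a(r-m)/Δ + i cos θ/sin² θ) ∂_φ f
  + (4 cot² θ - 2) f`. -/
def teukolskyRHS (f : Pt → ℂ) (x : Pt) : ℂ :=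
  -4 * ((x 1 - m : ℝ) : ℂ) * pd 1 f x
    - 4 * (((m * (x 1 ^ 2 - a ^ 2) / Del m a x - x 1 : ℝ) : ℂ)
        - Complex.I * ((a * Real.cos (x 2) : ℝ) : ℂ)) * pd 0 f x
    - 4 * (((a * (x 1 - m) / Del m a x : ℝ) : ℂ)
        + Complex.I * ((Real.cos (x 2) / Real.sin (x 2) ^ 2 : ℝ) : ℂ)) * pd 3 f x
    + ((4 * Real.cot (x 2) ^ 2 - 2 : ℝ) : ℂ) * f x

/-- The rescaled scalar `-(q̄/q) f`. -/
def alphaOf (f : Pt → ℂ) (x : Pt) : ℂ := -((starRingEnd ℂ) (q a x) / q a x) * f x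

/-- The complex null vector `(|q|/(√2 q)) (e_1 + i e_2)` of the Newman–Penrose tetrad. -/
def npM (x : Pt) : Fin 4 → ℂ := fun μ =>
  ((qAbs a x : ℝ) : ℂ) / (((√2 : ℝ) : ℂ) * q a x)
    * (((frame m a 0 x μ : ℝ) : ℂ) + Complex.I * ((frame m a 1 x μ : ℝ) : ℂ))

/-- The Newman–Penrose scalar `α^{[+2]} = -W(l, n, l, n)` of a Weyl tensor at `x`, where `l = e_4` and
`n` is the complex null vector `npM`. -/
def alphaNP (W : Fin 4 → Fin 4 → Fin 4 → Fin 4 → ℝ) (x : Pt) : ℂ :=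
  -evalC W (toC (frame m a 3 x)) (npM m a x) (toC (frame m a 3 x)) (npM m a x)

end Kerr

end KerrTeukolsky

end

/-!
The anti-self dual horizontal 2-tensors are the multiples `f • (e^1 - i e^2) ⊗ (e^1 - i e^2)`, where
`f` is the component along `e_1, e_1`. Horizontal derivatives, divergences and `⊗̂`-products
preserve this form up to the number of factors, and a derivative `∇_X` acts on the coefficient `f`
as `X + i k g(D_X e_1, e_2)` for `k` factors. Hence the tensorial Teukolsky operator is a second
order scalar operator times the same tensor, and all of its components vanish as soon as one does.

In the principal null frame the metric has constant coefficients, so Koszul's formula reads off the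
connection from the brackets of the frame, and the curvature from the connection. On Kerr everything
is expressed through `r/|q|²`, `a cos θ/|q|²`, `Δ/|q|²`, their first derivatives and `Λ`; comparing
the scalar operator with `□` in the frame leaves a first order operator and a potential, which are
those of the scalar wave equation.

The phase `p = -q̄/q` satisfies `e_i(p) = 2 i λ_i p` with real `λ_i`. The gradient term of
`□(p f) = p □f + 2 g(∇p, ∇f) + f □p` turns the first order terms of the tensorial equation into
those of the classical one. For a Weyl tensor, vanishing of the trace gives
`W(e_4, e_1, e_4, e_1) = -W(e_4, e_2, e_4, e_2)`, so that both null components are multiples of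
`W(e_4, e_1 + i e_2, e_4, e_1 + i e_2)`.
-/

open Topology

noncomputable section

namespace KerrTeukolsky

/-! ### Calculus in a chart -/

section Calculus

variable {F : Type*} [NormedAddCommGroup F] [NormedSpace ℝ F] {f h : Pt → F} {x : Pt}

theorem along_eq_fderiv (X : VF) (f : Pt → F) (x : Pt) : along X f x = fderiv ℝ f x (X x) := by
  conv_rhs => rw [pi_eq_sum_univ' (X x), map_sum]
  simp only [map_smul, along, pd]

theorem pd_eq_along (μ : Fin 4) (f : Pt → F) :
    pd μ f = along (fun _ => Pi.single μ 1) f :=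
  funext fun x => (along_eq_fderiv (fun _ => Pi.single μ 1) f x).symm

theorem along_congr {X : VF} (hfh : f =ᶠ[𝓝 x] h) : along X f x = along X h x := by
  simp only [along_eq_fderiv, hfh.fderiv_eq]

theorem along_const (X : VF) (c : F) (x : Pt) : along X (fun _ => c) x = 0 := by
  simp [along_eq_fderiv]

theorem along_add (X : VF) (hf : DifferentiableAt ℝ f x) (hh : DifferentiableAt ℝ h x) :
    along X (fun y => f y + h y) x = along X f x + along X h x := by
  simp [along_eq_fderiv, fderiv_fun_add hf hh]

theorem along_sub (X : VF) (hf : DifferentiableAt ℝ f x) (hh : DifferentiableAt ℝ h x) :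
    along X (fun y => f y - h y) x = along X f x - along X h x := by
  simp [along_eq_fderiv, fderiv_fun_sub hf hh]

theorem along_sum {ι : Type*} {s : Finset ι} {f : ι → Pt → F} (X : VF)
    (hf : ∀ i ∈ s, DifferentiableAt ℝ (f i) x) :
    along X (fun y => ∑ i ∈ s, f i y) x = ∑ i ∈ s, along X (f i) x := by
  simp [along_eq_fderiv, fderiv_fun_sum hf]

theorem along_mul {𝕜 : Type*} [NormedCommRing 𝕜] [NormedAlgebra ℝ 𝕜] {f h : Pt → 𝕜} (X : VF)
    (hf : DifferentiableAt ℝ f x) (hh : DifferentiableAt ℝ h x) :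
    along X (fun y => f y * h y) x = f x * along X h x + h x * along X f x := by
  simp [along_eq_fderiv, fderiv_fun_mul hf hh]

theorem along_const_mul {𝕜 : Type*} [NormedCommRing 𝕜] [NormedAlgebra ℝ 𝕜] {f : Pt → 𝕜} (X : VF)
    (c : 𝕜) (hf : DifferentiableAt ℝ f x) :
    along X (fun y => c * f y) x = c * along X f x := by
  simp [along_eq_fderiv, fderiv_const_mul hf]

theorem along_ofReal {f : Pt → ℝ} (X : VF) (hf : DifferentiableAt ℝ f x) :
    along X (fun y => (f y : ℂ)) x = ((along X f x : ℝ) : ℂ) := by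
  rw [along_eq_fderiv, along_eq_fderiv]
  exact DFunLike.congr_fun (Complex.ofRealCLM.hasFDerivAt.comp x hf.hasFDerivAt).fderiv (X x)

theorem along_sum_smul {ι : Type*} {s : Finset ι} {c : ι → ℝ} {X : ι → VF} {Y : VF}
    (hY : Y x = ∑ k ∈ s, c k • X k x) (f : Pt → F) :
    along Y f x = ∑ k ∈ s, c k • along (X k) f x := by
  simp only [along_eq_fderiv, hY, map_sum, map_smul]

theorem differentiableAt_fderiv (hf : ContDiffAt ℝ 2 f x) : DifferentiableAt ℝ (fderiv ℝ f) x :=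
  (hf.fderiv_right (m := 1) (by norm_num)).differentiableAt one_ne_zero

theorem differentiableAt_along (hf : ContDiffAt ℝ 2 f x) {Y : VF} (hY : DifferentiableAt ℝ Y x) :
    DifferentiableAt ℝ (along Y f) x := by
  rw [funext (along_eq_fderiv Y f)]
  exact (differentiableAt_fderiv hf).clm_apply hY

theorem along_along (hf : ContDiffAt ℝ 2 f x) (X : VF) {Y : VF} (hY : DifferentiableAt ℝ Y x) :
    along X (along Y f) x =
      fderiv ℝ (fderiv ℝ f) x (X x) (Y x) + along (fun y => along X Y y) f x := by
  rw [funext (along_eq_fderiv Y f), along_eq_fderiv,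
    fderiv_clm_apply (differentiableAt_fderiv hf) hY]
  simp [along_eq_fderiv, add_comm]

theorem along_apply {Y : VF} (hY : DifferentiableAt ℝ Y x) (X : VF) (l : Fin 4) :
    along X (fun y => Y y l) x = along X Y x l := by
  rw [along_eq_fderiv, along_eq_fderiv, fderiv_apply hY]
  rfl

theorem bracket_eq {X Y : VF} (hX : DifferentiableAt ℝ X x) (hY : DifferentiableAt ℝ Y x) :
    bracket X Y x = along X Y x - along Y X x := by
  ext l
  simp only [bracket, along_apply hX, along_apply hY, Pi.sub_apply]

theorem along_bracket (hf : ContDiffAt ℝ 2 f x) {X Y : VF} (hX : DifferentiableAt ℝ X x)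
    (hY : DifferentiableAt ℝ Y x) :
    along (bracket X Y) f x = along X (along Y f) x - along Y (along X f) x := by
  rw [along_along hf X hY, along_along hf Y hX,
    (hf.isSymmSndFDerivAt (by simp)).eq (X x) (Y x), add_sub_add_left_eq_sub]
  simp only [along_eq_fderiv _ f, bracket_eq hX hY, map_sub]

end Calculus

/-! ### The Levi-Civita connection -/

/-- The Christoffel symbols of the first kind,
`Γ_{k μν} = ½ (∂_μ g_{kν} + ∂_ν g_{kμ} - ∂_k g_{μν})`. -/
def christoffelLower (g : Metric) (k μ ν : Fin 4) (x : Pt) : ℝ :=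
  (1 / 2) *
    (pd μ (fun y => g y k ν) x + pd ν (fun y => g y k μ) x - pd k (fun y => g y μ ν) x)

section LeviCivita

variable {g : Metric} {x : Pt}

theorem sum_mul_christoffel (hg : IsUnit (g x).det) (k μ ν : Fin 4) :
    ∑ l, g x k l * christoffel g l μ ν x = christoffelLower g k μ ν x := by
  have raise : ∀ l, christoffel g l μ ν x =
      ((g x)⁻¹.mulVec fun k => christoffelLower g k μ ν x) l := fun l => by
    simp only [christoffel, christoffelLower, Matrix.mulVec, dotProduct, Finset.mul_sum,
      mul_left_comm]
  simp only [raise]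
  change ((g x).mulVec ((g x)⁻¹.mulVec _)) k = _
  rw [Matrix.mulVec_mulVec, Matrix.mul_nonsing_inv _ hg, Matrix.one_mulVec]

theorem christoffel_symm (hs : ∀ y, (g y).IsSymm) (l μ ν : Fin 4) :
    christoffel g l μ ν x = christoffel g l ν μ x := by
  simp only [christoffel, fun y => (hs y).apply μ ν]
  exact congrArg _ (Finset.sum_congr rfl fun k _ => by ring)

theorem pd_metric (hs : ∀ y, (g y).IsSymm) (μ κ ν : Fin 4) :
    pd μ (fun y => g y κ ν) x = christoffelLower g ν μ κ x + christoffelLower g κ μ ν x := by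
  simp only [christoffelLower, fun y => (hs y).apply κ ν, fun y => (hs y).apply μ ν,
    fun y => (hs y).apply μ κ]
  ring

theorem ip_eq_dotProduct (g : Metric) (X Y : VF) (x : Pt) :
    ip g X Y x = X x ⬝ᵥ (g x).mulVec (Y x) := by
  simp only [ip, dotProduct, Matrix.mulVec, Finset.mul_sum]
  exact Finset.sum_congr rfl fun μ _ => Finset.sum_congr rfl fun ν _ => by ring

theorem ip_symm (hs : ∀ y, (g y).IsSymm) (X Y : VF) : ip g X Y x = ip g Y X x := by
  rw [ip_eq_dotProduct, ip_eq_dotProduct, Matrix.dotProduct_mulVec, ← Matrix.mulVec_transpose,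
    (hs x).eq, dotProduct_comm]

theorem ip_sub_left {V X Y : VF} (hV : V x = X x - Y x) (Z : VF) :
    ip g V Z x = ip g X Z x - ip g Y Z x := by
  simp only [ip_eq_dotProduct, hV, sub_dotProduct]

theorem ip_sum_smul_left {ι : Type*} {s : Finset ι} {c : ι → ℝ} {X : ι → VF} {V : VF}
    (hV : V x = ∑ k ∈ s, c k • X k x) (Z : VF) :
    ip g V Z x = ∑ k ∈ s, c k * ip g (X k) Z x := by
  simp only [ip_eq_dotProduct, hV, sum_dotProduct, smul_dotProduct, smul_eq_mul]

theorem covD_sum_smul_left {ι : Type*} {s : Finset ι} {c : ι → ℝ} {X : ι → VF} {Y : VF}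
    (hY : Y x = ∑ k ∈ s, c k • X k x) (Z : VF) :
    covD g Y Z x = ∑ k ∈ s, c k • covD g (X k) Z x := by
  have covD_apply : ∀ (V : VF) (l : Fin 4), covD g V Z x l =
      along V (fun y => Z y l) x + V x ⬝ᵥ fun μ => ∑ ν, christoffel g l μ ν x * Z x ν :=
    fun V l => by
      simp only [covD, dotProduct, Finset.mul_sum, mul_left_comm, mul_assoc]
  ext l
  simp only [Finset.sum_apply, Pi.smul_apply, covD_apply, along_sum_smul hY, hY, sum_dotProduct,
    smul_dotProduct, smul_add, Finset.sum_add_distrib]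

theorem covD_sub_covD (hs : ∀ y, (g y).IsSymm) (X Y : VF) :
    bracket X Y x = covD g X Y x - covD g Y X x := by
  have torsion_free : ∀ l, ∑ μ, ∑ ν, christoffel g l μ ν x * Y x μ * X x ν =
      ∑ μ, ∑ ν, christoffel g l μ ν x * X x μ * Y x ν := fun l => by
    rw [Finset.sum_comm]
    simp only [christoffel_symm hs l, mul_right_comm]
  ext l
  simp only [covD, bracket, Pi.sub_apply, torsion_free l, add_sub_add_right_eq_sub]

theorem ip_covD (hg : IsUnit (g x).det) (hs : ∀ y, (g y).IsSymm) (Z X Y : VF) :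
    ip g (covD g Z X) Y x = ∑ κ, ∑ ν, (g x κ ν * along Z (fun y => X y κ) x * Y x ν +
      (∑ μ, Z x μ * christoffelLower g ν μ κ x) * X x κ * Y x ν) := by
  have lower : ∀ ν, ∑ l, g x l ν * ∑ μ, ∑ κ, christoffel g l μ κ x * Z x μ * X x κ =
      ∑ κ, (∑ μ, Z x μ * christoffelLower g ν μ κ x) * X x κ := fun ν => by
    simp only [← sum_mul_christoffel hg ν, Finset.mul_sum, Finset.sum_mul, (hs x).apply ν]
    rw [Finset.sum_comm_cycle]
    exact Finset.sum_congr rfl fun κ _ => Finset.sum_comm.trans <|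
      Finset.sum_congr rfl fun μ _ => Finset.sum_congr rfl fun l _ => by ring
  simp only [ip, covD, mul_add, add_mul, Finset.sum_add_distrib]
  congr 1
  conv_lhs => rw [Finset.sum_comm]
  conv_rhs => rw [Finset.sum_comm]
  simp only [← Finset.sum_mul, lower]

theorem along_ip (hg : IsUnit (g x).det) (hs : ∀ y, (g y).IsSymm)
    (hd : ∀ μ ν, DifferentiableAt ℝ (fun y => g y μ ν) x) (Z : VF) {X Y : VF}
    (hX : DifferentiableAt ℝ X x) (hY : DifferentiableAt ℝ Y x) :
    along Z (ip g X Y) x = ip g (covD g Z X) Y x + ip g X (covD g Z Y) x := by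
  have hX' := differentiableAt_pi.1 hX
  have hY' := differentiableAt_pi.1 hY
  have leibniz : along Z (ip g X Y) x = ∑ κ, ∑ ν,
      (g x κ ν * X x κ * along Z (fun y => Y y ν) x +
        Y x ν * (g x κ ν * along Z (fun y => X y κ) x +
          X x κ * along Z (fun y => g y κ ν) x)) := by
    change along Z (fun y => ∑ κ, ∑ ν, g y κ ν * X y κ * Y y ν) x = _
    rw [along_sum Z fun κ _ => DifferentiableAt.fun_sum fun ν _ =>
      ((hd κ ν).fun_mul (hX' κ)).fun_mul (hY' ν)]
    refine Finset.sum_congr rfl fun κ _ => ?_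
    rw [along_sum Z fun ν _ => ((hd κ ν).fun_mul (hX' κ)).fun_mul (hY' ν)]
    refine Finset.sum_congr rfl fun ν _ => ?_
    rw [along_mul Z ((hd κ ν).fun_mul (hX' κ)) (hY' ν), along_mul Z (hd κ ν) (hX' κ)]
  have along_metric : ∀ κ ν, along Z (fun y => g y κ ν) x =
      (∑ μ, Z x μ * christoffelLower g ν μ κ x) + ∑ μ, Z x μ * christoffelLower g κ μ ν x :=
    fun κ ν => by
      simp only [along, pd_metric hs, smul_eq_mul, mul_add, Finset.sum_add_distrib]
  have swapped : ip g X (covD g Z Y) x = ∑ κ, ∑ ν,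
      (g x κ ν * along Z (fun y => Y y ν) x * X x κ +
        (∑ μ, Z x μ * christoffelLower g κ μ ν x) * Y x ν * X x κ) := by
    rw [ip_symm hs, ip_covD hg hs, Finset.sum_comm]
    simp only [(hs x).apply]
  rw [leibniz, swapped, ip_covD hg hs, ← Finset.sum_add_distrib]
  refine Finset.sum_congr rfl fun κ _ => ?_
  rw [← Finset.sum_add_distrib]
  refine Finset.sum_congr rfl fun ν _ => ?_
  rw [along_metric]
  ring

end LeviCivita

/-! ### Frames with constant Gram matrix -/

/-- The matrix whose rows are the vectors of the frame at `x`. -/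
def frameMatrix (e : Fin 4 → VF) (x : Pt) : Matrix (Fin 4) (Fin 4) ℝ := Matrix.of fun i => e i x

/-- A rigid frame: one whose Gram matrix is, near `x`, a constant invertible matrix `N`. Null frames
and orthonormal frames are examples. The frame and the metric are differentiable at `x`. -/
structure IsRigidFrameAt (g : Metric) (e : Fin 4 → VF) (N : Matrix (Fin 4) (Fin 4) ℝ) (x : Pt) :
    Prop where
  isSymm : ∀ y, (g y).IsSymm
  isUnit_det : IsUnit N.det
  gram : ∀ᶠ y in 𝓝 x, ∀ i j, ip g (e i) (e j) y = N i j
  differentiableAt_metric : ∀ μ ν, DifferentiableAt ℝ (fun y => g y μ ν) x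
  differentiableAt_frame : ∀ i, DifferentiableAt ℝ (e i) x

/-- The covariant Hessian `∂_μ ∂_ν f - Γ^l_{μν} ∂_l f`. -/
def covHess (g : Metric) (f : Pt → ℂ) (μ ν : Fin 4) (x : Pt) : ℂ :=
  pd μ (pd ν f) x - ∑ l, (christoffel g l μ ν x : ℂ) * pd l f x

section PointwiseFrame

variable {g : Metric} {e : Fin 4 → VF} {N : Matrix (Fin 4) (Fin 4) ℝ} {x : Pt}

theorem frameMatrix_gram (hgram : ∀ i j, ip g (e i) (e j) x = N i j) :
    frameMatrix e x * g x * (frameMatrix e x).transpose = N := by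
  ext i j
  rw [← hgram i j, ip_eq_dotProduct, Matrix.mul_assoc]
  rfl

theorem isUnit_det_frameMatrix (hN : IsUnit N.det) (hgram : ∀ i j, ip g (e i) (e j) x = N i j) :
    IsUnit (frameMatrix e x).det := by
  rw [← frameMatrix_gram hgram, Matrix.det_mul, Matrix.det_mul] at hN
  exact isUnit_of_mul_isUnit_left (isUnit_of_mul_isUnit_left hN)

theorem isUnit_det_metric (hN : IsUnit N.det) (hgram : ∀ i j, ip g (e i) (e j) x = N i j) :
    IsUnit (g x).det := by
  rw [← frameMatrix_gram hgram, Matrix.det_mul, Matrix.det_mul] at hN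
  exact isUnit_of_mul_isUnit_right (isUnit_of_mul_isUnit_left hN)

theorem inv_metric_eq (hN : IsUnit N.det) (hgram : ∀ i j, ip g (e i) (e j) x = N i j) :
    (g x)⁻¹ = (frameMatrix e x).transpose * N⁻¹ * frameMatrix e x := by
  have hE := isUnit_det_frameMatrix hN hgram
  have hEt : IsUnit (frameMatrix e x).transpose.det := by rwa [Matrix.det_transpose]
  rw [← frameMatrix_gram hgram, Matrix.mul_inv_rev, Matrix.mul_inv_rev, ← Matrix.mul_assoc,
    Matrix.mul_nonsing_inv _ hEt, Matrix.one_mul, Matrix.mul_assoc, Matrix.nonsing_inv_mul _ hE,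
    Matrix.mul_one]

theorem sum_inv_metric_smul {F : Type*} [AddCommGroup F] [Module ℝ F] (hN : IsUnit N.det)
    (hgram : ∀ i j, ip g (e i) (e j) x = N i j) (T : Fin 4 → Fin 4 → F) :
    ∑ μ, ∑ ν, (g x)⁻¹ μ ν • T μ ν =
      ∑ i, ∑ j, N⁻¹ i j • ∑ μ, ∑ ν, (e i x μ * e j x ν) • T μ ν := by
  have inv_apply : ∀ μ ν, (g x)⁻¹ μ ν = ∑ i, ∑ j, N⁻¹ i j * (e i x μ * e j x ν) := fun μ ν => by
    simp only [inv_metric_eq hN hgram, frameMatrix, Matrix.mul_apply, Matrix.transpose_apply,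
      Matrix.of_apply, Finset.sum_mul]
    rw [Finset.sum_comm]
    exact Finset.sum_congr rfl fun i _ => Finset.sum_congr rfl fun j _ => by ring
  simp only [inv_apply, Finset.sum_smul, Finset.smul_sum, smul_smul]
  rw [Finset.sum_congr rfl fun μ _ => Finset.sum_comm, Finset.sum_comm]
  exact Finset.sum_congr rfl fun i _ => Finset.sum_comm_cycle

theorem eq_sum_frame (hs : ∀ y, (g y).IsSymm) (hN : IsUnit N.det)
    (hgram : ∀ i j, ip g (e i) (e j) x = N i j) (V : VF) :
    V x = ∑ k, (N⁻¹.mulVec fun l => ip g V (e l) x) k • e k x := by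
  have lower : (fun l => ip g V (e l) x) = (frameMatrix e x).mulVec ((g x).mulVec (V x)) := by
    funext l
    rw [ip_symm hs, ip_eq_dotProduct]
    rfl
  have raise := Matrix.vecMul_eq_sum (N⁻¹.mulVec fun l => ip g V (e l) x) (frameMatrix e x)
  refine Eq.trans ?_ raise
  rw [lower, ← Matrix.mulVec_transpose, Matrix.mulVec_mulVec, Matrix.mulVec_mulVec,
    ← inv_metric_eq hN hgram, Matrix.mulVec_mulVec,
    Matrix.nonsing_inv_mul _ (isUnit_det_metric hN hgram), Matrix.one_mulVec]

end PointwiseFrame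

theorem along_along_sub_along_covD {g : Metric} {f : Pt → ℂ} {x : Pt} (hf : ContDiffAt ℝ 2 f x)
    (X : VF) {Y : VF} (hY : DifferentiableAt ℝ Y x) :
    along X (along Y f) x - along (covD g X Y) f x =
      ∑ μ, ∑ ν, (X x μ * Y x ν) • covHess g f μ ν x := by
  have second_pd : ∀ μ ν, pd μ (pd ν f) x =
      fderiv ℝ (fderiv ℝ f) x (Pi.single μ 1) (Pi.single ν 1) := fun μ ν => by
    rw [pd_eq_along, pd_eq_along, along_along hf _ (differentiableAt_const _)]
    simp [along_eq_fderiv]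
  have second : fderiv ℝ (fderiv ℝ f) x (X x) (Y x) =
      ∑ μ, ∑ ν, (X x μ * Y x ν) • pd μ (pd ν f) x := by
    conv_lhs => rw [pi_eq_sum_univ' (X x), pi_eq_sum_univ' (Y x)]
    simp only [map_sum, map_smul, sum_apply, smul_apply,
      second_pd, smul_smul, Finset.smul_sum]
    rw [Finset.sum_comm]
    simp only [mul_comm]
  have first : along (covD g X Y) f x = along (fun y => along X Y y) f x +
      ∑ μ, ∑ ν, (X x μ * Y x ν) • ∑ l, (christoffel g l μ ν x : ℂ) * pd l f x := by
    change ∑ l, covD g X Y x l • pd l f x = ∑ l, along X Y x l • pd l f x + _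
    simp only [covD, along_apply hY, add_smul, Finset.sum_add_distrib, Finset.sum_smul,
      Finset.smul_sum]
    congr 1
    rw [← Finset.sum_comm_cycle]
    refine Finset.sum_congr rfl fun μ _ => Finset.sum_congr rfl fun ν _ =>
      Finset.sum_congr rfl fun l _ => ?_
    simp only [Complex.real_smul]
    push_cast
    ring
  rw [along_along hf X hY, second, first, add_comm, add_sub_add_left_eq_sub]
  simp only [covHess, smul_sub, Finset.sum_sub_distrib]

theorem covHess_mul {g : Metric} {h f : Pt → ℂ} {x : Pt} (hh : ContDiffAt ℝ 2 h x)
    (hf : ContDiffAt ℝ 2 f x) (μ ν : Fin 4) :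
    covHess g (fun y => h y * f y) μ ν x = h x * covHess g f μ ν x + f x * covHess g h μ ν x +
      (pd μ h x * pd ν f x + pd ν h x * pd μ f x) := by
  have diff : ∀ {k : Pt → ℂ}, ContDiffAt ℝ 2 k x → ∀ᶠ y in 𝓝 x, DifferentiableAt ℝ k y :=
    fun hk => (hk.eventually (by simp)).mono fun y hy => hy.differentiableAt two_ne_zero
  have dh := (diff hh).self_of_nhds
  have df := (diff hf).self_of_nhds
  have pd_prod : ∀ κ, ∀ᶠ y in 𝓝 x,
      pd κ (fun z => h z * f z) y = h y * pd κ f y + f y * pd κ h y := fun κ => by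
    filter_upwards [diff hh, diff hf] with y hy hy'
    simp only [pd_eq_along, along_mul _ hy hy']
  have d_pd : ∀ {k : Pt → ℂ}, ContDiffAt ℝ 2 k x → DifferentiableAt ℝ (pd ν k) x := fun hk => by
    rw [pd_eq_along]
    exact differentiableAt_along hk (differentiableAt_const _)
  have second : pd μ (pd ν fun y => h y * f y) x = h x * pd μ (pd ν f) x + pd ν f x * pd μ h x +
      (f x * pd μ (pd ν h) x + pd ν h x * pd μ f x) := by
    rw [pd_eq_along μ, along_congr (pd_prod ν), along_add _ (dh.fun_mul (d_pd hf))
      (df.fun_mul (d_pd hh)), along_mul _ dh (d_pd hf), along_mul _ df (d_pd hh)]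
    simp only [pd_eq_along μ]
  simp only [covHess, second, fun κ => (pd_prod κ).self_of_nhds, mul_add, Finset.sum_add_distrib,
    mul_left_comm _ (h x), mul_left_comm _ (f x), ← Finset.mul_sum]
  ring

namespace IsRigidFrameAt

variable {g : Metric} {e : Fin 4 → VF} {N : Matrix (Fin 4) (Fin 4) ℝ} {x : Pt}

theorem ip_covD_antisymm (H : IsRigidFrameAt g e N x) (X : VF) (j k : Fin 4) :
    ip g (covD g X (e j)) (e k) x = -ip g (covD g X (e k)) (e j) x := by
  have metric_compat := along_ip (isUnit_det_metric H.isUnit_det H.gram.self_of_nhds) H.isSymm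
    H.differentiableAt_metric X (H.differentiableAt_frame j) (H.differentiableAt_frame k)
  rw [along_congr (h := fun _ => N j k) (H.gram.mono fun y hy => hy j k), along_const,
    ip_symm H.isSymm (e j)] at metric_compat
  linarith

theorem ip_covD_eq_of_ip_bracket (H : IsRigidFrameAt g e N x) {G : Fin 4 → Fin 4 → Fin 4 → ℝ}
    (hG : ∀ i j k, G i j k = -G i k j)
    (hb : ∀ i j k, ip g (bracket (e i) (e j)) (e k) x = G i j k - G j i k) (i j k : Fin 4) :
    ip g (covD g (e i) (e j)) (e k) x = G i j k := by
  have torsion_free : ∀ i j k, ip g (covD g (e i) (e j)) (e k) x -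
      ip g (covD g (e j) (e i)) (e k) x = G i j k - G j i k := fun i j k => by
    rw [← hb, ip_sub_left (covD_sub_covD H.isSymm (e i) (e j))]
  linarith [H.ip_covD_antisymm (e i) j k, H.ip_covD_antisymm (e j) k i,
    H.ip_covD_antisymm (e k) i j,
    hG i j k, hG j k i, hG k i j, torsion_free i j k, torsion_free j k i, torsion_free k i j]

theorem along_covD (H : IsRigidFrameAt g e N x) {G : Fin 4 → Fin 4 → Fin 4 → ℝ}
    (hG : ∀ i j k, ip g (covD g (e i) (e j)) (e k) x = G i j k)
    {F : Type*} [NormedAddCommGroup F] [NormedSpace ℝ F] (f : Pt → F) (i j : Fin 4) :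
    along (covD g (e i) (e j)) f x = ∑ k, (N⁻¹.mulVec (G i j)) k • along (e k) f x := by
  refine along_sum_smul ?_ f
  simpa only [hG] using
    eq_sum_frame H.isSymm H.isUnit_det H.gram.self_of_nhds (covD g (e i) (e j))

theorem ip_covD_covD (H : IsRigidFrameAt g e N x) {G : Pt → Fin 4 → Fin 4 → Fin 4 → ℝ}
    (hG : ∀ᶠ y in 𝓝 x, ∀ i j k, ip g (covD g (e i) (e j)) (e k) y = G y i j k)
    (hd : ∀ i j k, DifferentiableAt ℝ (fun y => G y i j k) x) (i j z w : Fin 4) :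
    ip g (covD g (e i) (covD g (e j) (e z))) (e w) x = along (e i) (fun y => G y j z w) x +
      ∑ k, N⁻¹.mulVec (G x j z) k * G x i k w := by
  have hGx := hG.self_of_nhds
  have expand : covD g (e j) (e z) =ᶠ[𝓝 x]
      fun y => ∑ k, (N⁻¹.mulVec (G y j z)) k • e k y := by
    filter_upwards [H.gram, hG] with y hy hGy
    simpa only [hGy] using eq_sum_frame H.isSymm H.isUnit_det hy (covD g (e j) (e z))
  have diff_coeff : ∀ k, DifferentiableAt ℝ (fun y => N⁻¹.mulVec (G y j z) k) x := fun k => by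
    simp only [Matrix.mulVec, dotProduct]
    exact DifferentiableAt.fun_sum fun l _ => (hd j z l).const_mul (N⁻¹ k l)
  have diff_covD : DifferentiableAt ℝ (covD g (e j) (e z)) x :=
    DifferentiableAt.congr_of_eventuallyEq (DifferentiableAt.fun_sum fun k _ =>
      (diff_coeff k).fun_smul (H.differentiableAt_frame k)) expand
  have metric_compat := along_ip (isUnit_det_metric H.isUnit_det H.gram.self_of_nhds) H.isSymm
    H.differentiableAt_metric (e i) diff_covD (H.differentiableAt_frame w)
  have antisymm : ∀ k, ip g (e k) (covD g (e i) (e w)) x = -G x i k w := fun k => by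
    rw [ip_symm H.isSymm, H.ip_covD_antisymm, hGx]
  rw [along_congr (h := fun y => G y j z w) (hG.mono fun y hy => hy j z w),
    ip_sum_smul_left expand.self_of_nhds] at metric_compat
  simp only [antisymm, mul_neg, Finset.sum_neg_distrib] at metric_compat
  linarith

theorem riem_eq (H : IsRigidFrameAt g e N x) {G : Pt → Fin 4 → Fin 4 → Fin 4 → ℝ}
    (hG : ∀ᶠ y in 𝓝 x, ∀ i j k, ip g (covD g (e i) (e j)) (e k) y = G y i j k)
    (hd : ∀ i j k, DifferentiableAt ℝ (fun y => G y i j k) x) (w z i j : Fin 4) :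
    riem g (e w) (e z) (e i) (e j) x =
      along (e i) (fun y => G y j z w) x - along (e j) (fun y => G y i z w) x
      + ∑ k, N⁻¹.mulVec (G x j z) k * G x i k w - ∑ k, N⁻¹.mulVec (G x i z) k * G x j k w
      - ∑ k, N⁻¹.mulVec (G x i j - G x j i) k * G x k z w := by
  have hGx := hG.self_of_nhds
  have bracket_eq_sum : bracket (e i) (e j) x =
      ∑ k, (N⁻¹.mulVec (G x i j - G x j i)) k • e k x := by
    have comp : (fun l => ip g (bracket (e i) (e j)) (e l) x) = G x i j - G x j i := by
      funext l
      rw [ip_sub_left (covD_sub_covD H.isSymm (e i) (e j)), hGx, hGx, Pi.sub_apply]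
    rw [← comp]
    exact eq_sum_frame H.isSymm H.isUnit_det H.gram.self_of_nhds _
  have bracket_term : ip g (covD g (bracket (e i) (e j)) (e z)) (e w) x =
      ∑ k, N⁻¹.mulVec (G x i j - G x j i) k * G x k z w := by
    rw [ip_sum_smul_left (covD_sum_smul_left (X := e) bracket_eq_sum (e z))
      (X := fun k => covD g (e k) (e z))]
    simp only [hGx]
  rw [riem, ip_symm H.isSymm,
    ip_sub_left (X := fun y => covD g (e i) (covD g (e j) (e z)) y -
      covD g (e j) (covD g (e i) (e z)) y) (Y := covD g (bracket (e i) (e j)) (e z)) rfl,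
    ip_sub_left (X := covD g (e i) (covD g (e j) (e z)))
      (Y := covD g (e j) (covD g (e i) (e z))) rfl,
    H.ip_covD_covD hG hd, H.ip_covD_covD hG hd, bracket_term]
  ring

theorem box_eq (H : IsRigidFrameAt g e N x) {f : Pt → ℂ} (hf : ContDiffAt ℝ 2 f x) :
    box g f x = ∑ i, ∑ j, N⁻¹ i j •
      (along (e i) (along (e j) f) x - along (covD g (e i) (e j)) f x) := by
  simp only [along_along_sub_along_covD hf _ (H.differentiableAt_frame _),
    ← sum_inv_metric_smul H.isUnit_det H.gram.self_of_nhds]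
  rfl

theorem box_mul (H : IsRigidFrameAt g e N x) {h f : Pt → ℂ} (hh : ContDiffAt ℝ 2 h x)
    (hf : ContDiffAt ℝ 2 f x) :
    box g (fun y => h y * f y) x = h x * box g f x + f x * box g h x +
      2 * ∑ i, ∑ j, N⁻¹ i j • (along (e i) h x * along (e j) f x) := by
  have inv_symm : ((g x)⁻¹).IsSymm := by
    rw [Matrix.IsSymm, Matrix.transpose_nonsing_inv, (H.isSymm x).eq]
  have gradient : ∑ i, ∑ j, N⁻¹ i j • (along (e i) h x * along (e j) f x) =
      ∑ μ, ∑ ν, (g x)⁻¹ μ ν • (pd μ h x * pd ν f x) := by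
    rw [sum_inv_metric_smul H.isUnit_det H.gram.self_of_nhds]
    simp only [along, Finset.sum_mul_sum, smul_mul_smul_comm]
  have swapped : ∑ μ, ∑ ν, (g x)⁻¹ μ ν • (pd ν h x * pd μ f x) =
      ∑ μ, ∑ ν, (g x)⁻¹ μ ν • (pd μ h x * pd ν f x) := by
    rw [Finset.sum_comm]
    simp only [inv_symm.apply]
  have box_eq_sum : ∀ k : Pt → ℂ, box g k x = ∑ μ, ∑ ν, (g x)⁻¹ μ ν • covHess g k μ ν x :=
    fun k => rfl
  have pull : ∀ (c : ℂ) (k : Pt → ℂ), ∑ μ, ∑ ν, (g x)⁻¹ μ ν • (c * covHess g k μ ν x) =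
      c * box g k x := fun c k => by
    simp only [box_eq_sum, Finset.mul_sum, mul_smul_comm]
  rw [box_eq_sum]
  simp only [covHess_mul hh hf, gradient, smul_add, Finset.sum_add_distrib, swapped, pull]
  ring

end IsRigidFrameAt

/-! ### Anti-self dual horizontal tensors -/

/-- The anti-self dual horizontal 1-form `e^1 - i e^2`, by its components. -/
def asdForm : Fin 2 → ℂ := ![1, -Complex.I]

/-- The tensor `(e^1 - i e^2) ⊗ (e^1 - i e^2)`, which spans `𝒮_2(ℂ)`. -/
def asdTensor (a b : Fin 2) : ℂ := asdForm a * asdForm b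

theorem asdForm_zero : asdForm 0 = 1 := rfl

theorem asdForm_one : asdForm 1 = -Complex.I := rfl

theorem sum_asdForm_mul_self : ∑ a, asdForm a * asdForm a = 0 := by
  simp [asdForm]

theorem sum_conj_asdForm_mul_self : ∑ a, (starRingEnd ℂ) (asdForm a) * asdForm a = 2 := by
  norm_num [asdForm]

theorem add_I_mul_sum_eps (w : Fin 2 → ℂ) (a : Fin 2) :
    w a + Complex.I * ∑ c, (eps a c : ℂ) * w c = (w 0 + Complex.I * w 1) * asdForm a := by
  fin_cases a
  · simp [asdForm, eps]
  · simp only [eps, asdForm, Fin.sum_univ_two, Fin.mk_one, Matrix.cons_val_zero,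
      Matrix.cons_val_one, Complex.ofReal_neg, Complex.ofReal_one, Complex.ofReal_zero]
    linear_combination w 1 * Complex.I_sq

theorem sub_I_mul_sum_eps (w : Fin 2 → ℂ) (a : Fin 2) :
    w a - Complex.I * ∑ c, (eps a c : ℂ) * w c =
      (w 0 - Complex.I * w 1) * (starRingEnd ℂ) (asdForm a) := by
  fin_cases a
  · simp [asdForm, eps]
  · simp only [eps, asdForm, Fin.sum_univ_two, Fin.mk_one, Matrix.cons_val_zero, map_neg,
      Matrix.cons_val_one, Complex.ofReal_neg, Complex.ofReal_one, Complex.ofReal_zero,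
      Complex.conj_I]
    linear_combination w 1 * Complex.I_sq

theorem IsAntiSelfDual.eq_mul_asdTensor {U : Fin 2 → Fin 2 → ℂ} (hU : IsAntiSelfDual U)
    (a b : Fin 2) : U a b = U 0 0 * asdTensor a b := by
  obtain ⟨u, symm, traceless, hU⟩ := hU
  have u11 : (u 1 1 : ℂ) = -u 0 0 := by
    exact_mod_cast eq_neg_of_add_eq_zero_right (Fin.sum_univ_two (fun a => u a a) ▸ traceless)
  have first_slot : ∀ a b, U a b = ((u 0 b : ℂ) + Complex.I * u 1 b) * asdForm a := fun a b => by
    rw [hU, add_I_mul_sum_eps fun c => (u c b : ℂ)]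
  have second_slot : ∀ b, (u 0 b : ℂ) + Complex.I * u 1 b =
      ((u 0 0 : ℂ) + Complex.I * u 0 1) * asdForm b := fun b => by
    fin_cases b
    · simp [asdForm, symm 1 0]
    · simp only [Fin.mk_one, asdForm_one, u11]
      linear_combination (u 0 1 : ℂ) * Complex.I_sq
  rw [first_slot a b, first_slot 0 0, second_slot b, second_slot 0, asdTensor]
  simp only [asdForm_zero, mul_one]
  ring

section AntiSelfDual

variable (g : Metric) (e : Fin 4 → VF)

/-- The derivative `X(f) + i k g(D_X e_1, e_2) f` of a scalar of spin weight `k`: it is `∇_X` on the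
coefficient `f` of the `k`-fold tensor power of `e^1 - i e^2`. -/
def spinD (k : ℕ) (X : VF) (f : Pt → ℂ) (x : Pt) : ℂ :=
  along X f x + k * Complex.I * (hconn g e X 0 1 x : ℂ) * f x

/-- `⁽ᶜ⁾∇_3` on the coefficient of an anti-self dual 2-tensor of conformal type `s`. -/
def spin3 (s : ℝ) (f : Pt → ℂ) (x : Pt) : ℂ :=
  spinD g e 2 (e 2) f x - 2 * (s : ℂ) * (omb g e x : ℂ) * f x

/-- `⁽ᶜ⁾∇_4` on the coefficient of an anti-self dual 2-tensor of conformal type `s`. -/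
def spin4 (s : ℝ) (f : Pt → ℂ) (x : Pt) : ℂ :=
  spinD g e 2 (e 3) f x + 2 * (s : ℂ) * (om g e x : ℂ) * f x

/-- `⁽ᶜ⁾∇_c` on the coefficient of the `k`-fold tensor power of `e^1 - i e^2`, for conformal
type `s`. -/
def spinH (k : ℕ) (s : ℝ) (c : Fin 2) (f : Pt → ℂ) (x : Pt) : ℂ :=
  spinD g e k (e (hz c)) f x + (s : ℂ) * (zeta g e c x : ℂ) * f x

/-- `⁽ᶜ⁾𝒟̄ ·` on the coefficient of an anti-self dual 2-tensor of conformal type `s`; the result is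
the coefficient of an anti-self dual 1-form. -/
def spinDiv (s : ℝ) (f : Pt → ℂ) (x : Pt) : ℂ :=
  2 * (spinH g e 2 s 0 f x - Complex.I * spinH g e 2 s 1 f x)

/-- `⁽ᶜ⁾𝒟 ⊗̂` on the coefficient of an anti-self dual 1-form of conformal type `s`; the result is
the coefficient of an anti-self dual 2-tensor. -/
def spinHat (s : ℝ) (f : Pt → ℂ) (x : Pt) : ℂ :=
  spinH g e 1 s 0 f x + Complex.I * spinH g e 1 s 1 f x

/-- The Teukolsky operator on the coefficient of an anti-self dual 2-tensor of conformal
type `2`. -/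
def teukolskyScalar (f : Pt → ℂ) (x : Pt) : ℂ :=
  -spin4 g e 1 (spin3 g e 2 f) x + (1 / 2) * spinHat g e 2 (spinDiv g e 2 f) x
  + (-(1 / 2) * trX g e x - 2 * (starRingEnd ℂ) (trX g e x)) * spin3 g e 2 f x
  - (1 / 2) * trXb g e x * spin4 g e 2 f x
  + (2 * bigH g e x 0 * spinDiv g e 2 f x
    + 2 * ((etab g e 0 x : ℂ) * spinH g e 2 2 0 f x + (etab g e 1 x : ℂ) * spinH g e 2 2 1 f x))
  + (-((starRingEnd ℂ) (trX g e x)) * trXb g e x + 2 * (starRingEnd ℂ) (curvP g e x)) * f x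
  + 4 * bigH g e x 0 * (starRingEnd ℂ) (bigHb g e x 0) * f x

variable {g e} {A : HTensor} {F : HForm} {f : Pt → ℂ} {x : Pt} {X : VF}

theorem bigH_eq_mul_asdForm (a : Fin 2) : bigH g e x a = bigH g e x 0 * asdForm a := by
  simp only [bigH, add_I_mul_sum_eps fun b => (eta g e b x : ℂ)]
  simp [asdForm]

theorem bigHb_eq_mul_asdForm (a : Fin 2) : bigHb g e x a = bigHb g e x 0 * asdForm a := by
  simp only [bigHb, add_I_mul_sum_eps fun b => (etab g e b x : ℂ)]
  simp [asdForm]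

theorem bigHb_add_conj (a : Fin 2) :
    bigHb g e x a + (starRingEnd ℂ) (bigHb g e x a) = 2 * (etab g e a x : ℂ) := by
  simp only [bigHb, map_add, map_mul, map_sum, Complex.conj_I, Complex.conj_ofReal]
  ring

theorem along_mul_const (hf : DifferentiableAt ℝ f x) (c : ℂ) :
    along X (fun y => f y * c) x = along X f x * c := by
  rw [along_mul X hf (differentiableAt_const c), along_const]
  ring

theorem sum_hconn_mul_asdForm (hX : ∀ a b, hconn g e X a b x = -hconn g e X b a x) (a : Fin 2) :
    ∑ c, (hconn g e X a c x : ℂ) * asdForm c =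
      -(Complex.I * (hconn g e X 0 1 x : ℂ) * asdForm a) := by
  have diag : ∀ a, hconn g e X a a x = 0 := fun a => self_eq_neg.mp (hX a a)
  fin_cases a
  · simp only [Fin.zero_eta, Fin.sum_univ_two, diag, asdForm_zero, asdForm_one]
    push_cast
    ring
  · simp only [Fin.mk_one, Fin.sum_univ_two, diag, hX 1 0, asdForm_zero, asdForm_one]
    push_cast
    linear_combination -(hconn g e X 0 1 x : ℂ) * Complex.I_sq

theorem nabla1_asd (hf : DifferentiableAt ℝ f x) (hF : ∀ᶠ y in 𝓝 x, ∀ a, F y a = f y * asdForm a)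
    (hX : ∀ a b, hconn g e X a b x = -hconn g e X b a x) (a : Fin 2) :
    nabla1 g e X F x a = spinD g e 1 X f x * asdForm a := by
  rw [nabla1, along_congr (hF.mono fun y hy => hy a), along_mul_const hf]
  simp only [hF.self_of_nhds, mul_left_comm _ (f x), ← Finset.mul_sum, sum_hconn_mul_asdForm hX,
    spinD]
  push_cast
  ring

theorem nabla2_asd (hf : DifferentiableAt ℝ f x)
    (hA : ∀ᶠ y in 𝓝 x, ∀ a b, A y a b = f y * asdTensor a b)
    (hX : ∀ a b, hconn g e X a b x = -hconn g e X b a x) (a b : Fin 2) :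
    nabla2 g e X A x a b = spinD g e 2 X f x * asdTensor a b := by
  have first_slot : ∑ c, (hconn g e X a c x : ℂ) * (f x * asdTensor c b) =
      f x * asdForm b * ∑ c, (hconn g e X a c x : ℂ) * asdForm c := by
    rw [Finset.mul_sum]
    exact Finset.sum_congr rfl fun c _ => by rw [asdTensor]; ring
  have second_slot : ∑ c, (hconn g e X b c x : ℂ) * (f x * asdTensor a c) =
      f x * asdForm a * ∑ c, (hconn g e X b c x : ℂ) * asdForm c := by
    rw [Finset.mul_sum]
    exact Finset.sum_congr rfl fun c _ => by rw [asdTensor]; ring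
  rw [nabla2, along_congr (hA.mono fun y hy => hy a b), along_mul_const hf]
  simp only [hA.self_of_nhds, first_slot, second_slot, sum_hconn_mul_asdForm hX, spinD]
  rw [asdTensor]
  push_cast
  ring

theorem cNabla3_asd (hf : DifferentiableAt ℝ f x)
    (hA : ∀ᶠ y in 𝓝 x, ∀ a b, A y a b = f y * asdTensor a b)
    (hX : ∀ X a b, hconn g e X a b x = -hconn g e X b a x) (s : ℝ) (a b : Fin 2) :
    cNabla3 g e s A x a b = spin3 g e s f x * asdTensor a b := by
  rw [cNabla3, nabla2_asd hf hA (hX _), hA.self_of_nhds, spin3]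
  ring

theorem cNabla4_asd (hf : DifferentiableAt ℝ f x)
    (hA : ∀ᶠ y in 𝓝 x, ∀ a b, A y a b = f y * asdTensor a b)
    (hX : ∀ X a b, hconn g e X a b x = -hconn g e X b a x) (s : ℝ) (a b : Fin 2) :
    cNabla4 g e s A x a b = spin4 g e s f x * asdTensor a b := by
  rw [cNabla4, nabla2_asd hf hA (hX _), hA.self_of_nhds, spin4]
  ring

theorem cNablaH1_asd (hf : DifferentiableAt ℝ f x)
    (hF : ∀ᶠ y in 𝓝 x, ∀ a, F y a = f y * asdForm a)
    (hX : ∀ X a b, hconn g e X a b x = -hconn g e X b a x) (s : ℝ) (c a : Fin 2) :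
    cNablaH1 g e s c F x a = spinH g e 1 s c f x * asdForm a := by
  rw [cNablaH1, nabla1_asd hf hF (hX _), hF.self_of_nhds, spinH]
  ring

theorem cNablaH2_asd (hf : DifferentiableAt ℝ f x)
    (hA : ∀ᶠ y in 𝓝 x, ∀ a b, A y a b = f y * asdTensor a b)
    (hX : ∀ X a b, hconn g e X a b x = -hconn g e X b a x) (s : ℝ) (c a b : Fin 2) :
    cNablaH2 g e s c A x a b = spinH g e 2 s c f x * asdTensor a b := by
  rw [cNablaH2, nabla2_asd hf hA (hX _), hA.self_of_nhds, spinH]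
  ring

theorem cDbarDiv_asd (hf : DifferentiableAt ℝ f x)
    (hA : ∀ᶠ y in 𝓝 x, ∀ a b, A y a b = f y * asdTensor a b)
    (hX : ∀ X a b, hconn g e X a b x = -hconn g e X b a x) (s : ℝ) (a : Fin 2) :
    cDbarDiv g e s A x a = spinDiv g e s f x * asdForm a := by
  have contraction : ∀ b, cNablaH2 g e s b A x b a
      - Complex.I * ∑ c, (eps b c : ℂ) * cNablaH2 g e s c A x b a =
      (spinH g e 2 s 0 f x - Complex.I * spinH g e 2 s 1 f x) * asdForm a *
        ((starRingEnd ℂ) (asdForm b) * asdForm b) := fun b => by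
    rw [sub_I_mul_sum_eps fun c => cNablaH2 g e s c A x b a]
    simp only [cNablaH2_asd hf hA hX, asdTensor]
    ring
  rw [cDbarDiv, Finset.sum_congr rfl fun b _ => contraction b, ← Finset.mul_sum,
    sum_conj_asdForm_mul_self, spinDiv]
  ring

theorem cDHat_asd (hf : DifferentiableAt ℝ f x)
    (hF : ∀ᶠ y in 𝓝 x, ∀ a, F y a = f y * asdForm a)
    (hX : ∀ X a b, hconn g e X a b x = -hconn g e X b a x) (s : ℝ) (a b : Fin 2) :
    cDHat g e s F x a b = spinHat g e s f x * asdTensor a b := by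
  have component : ∀ a b, cD1 g e s F x a b = spinHat g e s f x * (asdForm a * asdForm b) :=
    fun a b => by
      rw [cD1, add_I_mul_sum_eps fun c => cNablaH1 g e s c F x b]
      simp only [cNablaH1_asd hf hF hX, spinHat]
      ring
  simp only [cDHat, component, ← Finset.mul_sum, sum_asdForm_mul_self, asdTensor, mul_zero,
    ite_self]
  ring

theorem HHbU_asd (hA : ∀ a b, A x a b = f x * asdTensor a b) (a b : Fin 2) :
    HHbU g e A x a b =
      4 * bigH g e x 0 * (starRingEnd ℂ) (bigHb g e x 0) * f x * asdTensor a b := by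
  have contraction : ∀ c, ∑ d, (starRingEnd ℂ) (bigHb g e x d) * A x c d =
      2 * (starRingEnd ℂ) (bigHb g e x 0) * f x * asdForm c := fun c => by
    have summand : ∀ d, (starRingEnd ℂ) (bigHb g e x d) * A x c d =
        (starRingEnd ℂ) (bigHb g e x 0) * f x * asdForm c *
          ((starRingEnd ℂ) (asdForm d) * asdForm d) := fun d => by
      rw [bigHb_eq_mul_asdForm, hA, asdTensor, map_mul]
      ring
    rw [Finset.sum_congr rfl fun d _ => summand d, ← Finset.mul_sum, sum_conj_asdForm_mul_self]
    ring
  have trace : ∑ c, bigH g e x c * (2 * (starRingEnd ℂ) (bigHb g e x 0) * f x * asdForm c) = 0 := by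
    have summand : ∀ c, bigH g e x c *
        (2 * (starRingEnd ℂ) (bigHb g e x 0) * f x * asdForm c) =
        bigH g e x 0 * (2 * (starRingEnd ℂ) (bigHb g e x 0) * f x) * (asdForm c * asdForm c) :=
      fun c => by
        rw [bigH_eq_mul_asdForm]
        ring
    rw [Finset.sum_congr rfl fun c _ => summand c, ← Finset.mul_sum, sum_asdForm_mul_self,
      mul_zero]
  simp only [HHbU, contraction, trace, ite_self]
  rw [bigH_eq_mul_asdForm a, bigH_eq_mul_asdForm b, asdTensor]
  ring

theorem sum_bigH_mul_asd (h : Fin 2 → ℂ) :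
    ∑ c, (4 * bigH g e x c + bigHb g e x c + (starRingEnd ℂ) (bigHb g e x c)) * h c =
      4 * bigH g e x 0 * (h 0 - Complex.I * h 1)
        + 2 * ((etab g e 0 x : ℂ) * h 0 + (etab g e 1 x : ℂ) * h 1) := by
  simp only [add_assoc, bigHb_add_conj, Fin.sum_univ_two, bigH_eq_mul_asdForm 1]
  simp only [asdForm_one]
  ring

theorem teukolskyOp_asd (hf : ∀ᶠ y in 𝓝 x, DifferentiableAt ℝ f y)
    (h3 : DifferentiableAt ℝ (spin3 g e 2 f) x) (hdiv : DifferentiableAt ℝ (spinDiv g e 2 f) x)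
    (hA : ∀ᶠ y in 𝓝 x, ∀ a b, A y a b = f y * asdTensor a b)
    (hX : ∀ᶠ y in 𝓝 x, ∀ X a b, hconn g e X a b y = -hconn g e X b a y) (a b : Fin 2) :
    teukolskyOp g e A x a b = teukolskyScalar g e f x * asdTensor a b := by
  have hA' := eventually_eventually_nhds.2 hA
  have nabla3 : ∀ᶠ y in 𝓝 x, ∀ a b, cNabla3 g e 2 A y a b = spin3 g e 2 f y * asdTensor a b := by
    filter_upwards [hf, hA', hX] with y hfy hAy hXy using cNabla3_asd hfy hAy hXy 2
  have div : ∀ᶠ y in 𝓝 x, ∀ a, cDbarDiv g e 2 A y a = spinDiv g e 2 f y * asdForm a := by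
    filter_upwards [hf, hA', hX] with y hfy hAy hXy using cDbarDiv_asd hfy hAy hXy 2
  have hfx := hf.self_of_nhds
  have hXx := hX.self_of_nhds
  rw [teukolskyOp, cNabla4_asd h3 nabla3 hXx, cDHat_asd hdiv div hXx, nabla3.self_of_nhds,
    cNabla4_asd hfx hA hXx, HHbU_asd hA.self_of_nhds, hA.self_of_nhds, sum_bigH_mul_asd]
  simp only [cNablaH2_asd hfx hA hXx, teukolskyScalar, spinDiv]
  ring

end AntiSelfDual

/-! ### Functions of `r` and `θ` -/

section Grad

/-- `f` is differentiable at `x` with `∂_r f = u`, `∂_θ f = v` and `∂_t f = ∂_φ f = 0`. -/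
structure HasGrad {F : Type*} [NormedAddCommGroup F] [NormedSpace ℝ F] (f : Pt → F) (u v : F)
    (x : Pt) : Prop where
  differentiableAt : DifferentiableAt ℝ f x
  fderiv_eq : ∀ X, fderiv ℝ f x X = X 1 • u + X 2 • v

namespace HasGrad

variable {F : Type*} [NormedAddCommGroup F] [NormedSpace ℝ F] {f h : Pt → F} {u v u' v' : F}
  {x : Pt}

theorem along (H : HasGrad f u v x) (X : VF) : along X f x = X x 1 • u + X x 2 • v := by
  rw [along_eq_fderiv, H.fderiv_eq]

theorem congr (H : HasGrad f u v x) (hf : ∀ y, h y = f y) (hu : u = u') (hv : v = v') :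
    HasGrad h u' v' x := by
  rwa [funext hf, ← hu, ← hv]

theorem const (c : F) (x : Pt) : HasGrad (fun _ => c) 0 0 x :=
  ⟨differentiableAt_const c, fun X => by simp⟩

theorem r (x : Pt) : HasGrad (fun y => y 1) 1 0 x :=
  ⟨differentiableAt_apply 1 x, fun X => by simp [(hasFDerivAt_apply (𝕜 := ℝ) 1 x).fderiv]⟩

theorem theta (x : Pt) : HasGrad (fun y => y 2) 0 1 x :=
  ⟨differentiableAt_apply 2 x, fun X => by simp [(hasFDerivAt_apply (𝕜 := ℝ) 2 x).fderiv]⟩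

theorem add (H : HasGrad f u v x) (H' : HasGrad h u' v' x) :
    HasGrad (fun y => f y + h y) (u + u') (v + v') x :=
  ⟨H.differentiableAt.fun_add H'.differentiableAt, fun X => by
    rw [fderiv_fun_add H.differentiableAt H'.differentiableAt, add_apply, H.fderiv_eq,
      H'.fderiv_eq]
    module⟩

theorem neg (H : HasGrad f u v x) : HasGrad (fun y => -f y) (-u) (-v) x :=
  ⟨H.differentiableAt.fun_neg, fun X => by
    rw [fderiv_fun_neg, neg_apply, H.fderiv_eq]
    module⟩

theorem sub (H : HasGrad f u v x) (H' : HasGrad h u' v' x) :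
    HasGrad (fun y => f y - h y) (u - u') (v - v') x :=
  (H.add H'.neg).congr (fun _ => sub_eq_add_neg _ _) (sub_eq_add_neg _ _).symm
    (sub_eq_add_neg _ _).symm

theorem mul {𝕜 : Type*} [NormedCommRing 𝕜] [NormedAlgebra ℝ 𝕜] {f h : Pt → 𝕜} {u v u' v' : 𝕜}
    (H : HasGrad f u v x) (H' : HasGrad h u' v' x) :
    HasGrad (fun y => f y * h y) (u * h x + f x * u') (v * h x + f x * v') x :=
  ⟨H.differentiableAt.fun_mul H'.differentiableAt, fun X => by
    rw [fderiv_fun_mul H.differentiableAt H'.differentiableAt, add_apply, smul_apply, smul_apply,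
      H.fderiv_eq, H'.fderiv_eq, smul_eq_mul, smul_eq_mul]
    simp only [Algebra.smul_def]
    ring⟩

theorem inv {𝕜 : Type*} [NormedField 𝕜] [NormedAlgebra ℝ 𝕜] {f : Pt → 𝕜} {u v : 𝕜}
    (H : HasGrad f u v x) (hf : f x ≠ 0) :
    HasGrad (fun y => (f y)⁻¹) (-u / f x ^ 2) (-v / f x ^ 2) x := by
  have hinv := (hasFDerivAt_inv' (𝕜 := ℝ) hf).comp x H.differentiableAt.hasFDerivAt
  refine ⟨hinv.differentiableAt, fun X => ?_⟩
  have chain := DFunLike.congr_fun hinv.fderiv X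
  simp only [ContinuousLinearMap.comp_apply, neg_apply, ContinuousLinearMap.mulLeftRight_apply,
    H.fderiv_eq, Algebra.smul_def] at chain ⊢
  refine chain.trans ?_
  field_simp
  ring

theorem div {𝕜 : Type*} [NormedField 𝕜] [NormedAlgebra ℝ 𝕜] {f h : Pt → 𝕜} {u v u' v' : 𝕜}
    (H : HasGrad f u v x) (H' : HasGrad h u' v' x) (hh : h x ≠ 0) :
    HasGrad (fun y => f y / h y) ((u * h x - f x * u') / h x ^ 2)
      ((v * h x - f x * v') / h x ^ 2) x := by
  refine (H.mul (H'.inv hh)).congr (fun y => div_eq_mul_inv _ _) ?_ ?_ <;>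
  · field_simp
    ring

theorem comp {f : Pt → ℝ} {u v φ' : ℝ} {φ : ℝ → ℝ} (H : HasGrad f u v x)
    (hφ : HasDerivAt φ φ' (f x)) : HasGrad (fun y => φ (f y)) (φ' * u) (φ' * v) x := by
  have hcomp := hφ.comp_hasFDerivAt x H.differentiableAt.hasFDerivAt
  refine ⟨hcomp.differentiableAt, fun X => ?_⟩
  have chain := DFunLike.congr_fun hcomp.fderiv X
  simp only [smul_apply, H.fderiv_eq, smul_eq_mul] at chain ⊢
  refine chain.trans ?_
  ring

theorem pow {f : Pt → ℝ} {u v : ℝ} (H : HasGrad f u v x) (n : ℕ) :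
    HasGrad (fun y => f y ^ n) (n * f x ^ (n - 1) * u) (n * f x ^ (n - 1) * v) x :=
  H.comp (hasDerivAt_pow n _)

theorem cos (x : Pt) : HasGrad (fun y => Real.cos (y 2)) 0 (-Real.sin (x 2)) x :=
  ((theta x).comp (Real.hasDerivAt_cos _)).congr (fun _ => rfl) (mul_zero _) (mul_one _)

theorem sin (x : Pt) : HasGrad (fun y => Real.sin (y 2)) 0 (Real.cos (x 2)) x :=
  ((theta x).comp (Real.hasDerivAt_sin _)).congr (fun _ => rfl) (mul_zero _) (mul_one _)

theorem ofReal {f : Pt → ℝ} {u v : ℝ} (H : HasGrad f u v x) :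
    HasGrad (fun y => (f y : ℂ)) (u : ℂ) (v : ℂ) x := by
  have hcomp := Complex.ofRealCLM.hasFDerivAt.comp x H.differentiableAt.hasFDerivAt
  refine ⟨hcomp.differentiableAt, fun X => ?_⟩
  have chain := DFunLike.congr_fun hcomp.fderiv X
  simp only [ContinuousLinearMap.comp_apply, Complex.ofRealCLM_apply, H.fderiv_eq] at chain
  refine chain.trans ?_
  simp

theorem pi {f : Pt → Fin 4 → ℝ} {u v : Fin 4 → ℝ}
    (H : ∀ l, HasGrad (fun y => f y l) (u l) (v l) x) : HasGrad f u v x := by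
  have hd : DifferentiableAt ℝ f x := differentiableAt_pi.2 fun l => (H l).differentiableAt
  refine ⟨hd, fun X => funext fun l => ?_⟩
  have component := (H l).fderiv_eq X
  rwa [fderiv_apply hd l] at component

theorem vec {f₀ f₁ f₂ f₃ : Pt → ℝ} {u₀ u₁ u₂ u₃ v₀ v₁ v₂ v₃ : ℝ} (H₀ : HasGrad f₀ u₀ v₀ x)
    (H₁ : HasGrad f₁ u₁ v₁ x) (H₂ : HasGrad f₂ u₂ v₂ x) (H₃ : HasGrad f₃ u₃ v₃ x) :
    HasGrad (fun y => ![f₀ y, f₁ y, f₂ y, f₃ y]) ![u₀, u₁, u₂, u₃] ![v₀, v₁, v₂, v₃] x :=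
  pi fun l => by fin_cases l <;> assumption

end HasGrad

end Grad

/-! ### The Kerr metric and its principal null frame -/

/-- The Gram matrix of a null frame `(e_1, e_2, e_3, e_4)`. -/
def nullGram : Matrix (Fin 4) (Fin 4) ℝ := !![1, 0, 0, 0; 0, 1, 0, 0; 0, 0, 0, -2; 0, 0, -2, 0]

theorem nullGram_mul_self_inv :
    nullGram * !![1, 0, 0, 0; 0, 1, 0, 0; 0, 0, 0, -2⁻¹; 0, 0, -2⁻¹, 0] = 1 := by
  ext i j
  fin_cases i <;> fin_cases j <;> simp [nullGram, Matrix.mul_apply, Fin.sum_univ_four]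

theorem isUnit_det_nullGram : IsUnit nullGram.det :=
  (Matrix.isUnit_iff_isUnit_det _).1 (.of_mul_eq_one _ nullGram_mul_self_inv)

theorem nullGram_inv_mulVec (w : Fin 4 → ℝ) :
    nullGram⁻¹.mulVec w = ![w 0, w 1, -(1 / 2) * w 3, -(1 / 2) * w 2] := by
  rw [Matrix.inv_eq_right_inv nullGram_mul_self_inv]
  ext i
  fin_cases i <;> simp [Matrix.mulVec, dotProduct, Fin.sum_univ_four]

theorem sum_nullGram_inv_smul {F : Type*} [AddCommGroup F] [Module ℝ F]
    (T : Fin 4 → Fin 4 → F) :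
    ∑ i, ∑ j, nullGram⁻¹ i j • T i j = T 0 0 + T 1 1 - (1 / 2 : ℝ) • (T 2 3 + T 3 2) := by
  rw [Matrix.inv_eq_right_inv nullGram_mul_self_inv]
  simp only [Fin.sum_univ_four, Matrix.of_apply, Matrix.cons_val]
  module

section KerrMetric

variable {m a : ℝ} {x : Pt}

theorem qSq_pos (hx : x ∈ patch m a) : 0 < qSq a x := by
  have := hx.1
  unfold qSq
  positivity

theorem qAbs_pos (hx : x ∈ patch m a) : 0 < qAbs a x := Real.sqrt_pos.2 (qSq_pos hx)

theorem qAbs_sq (hx : x ∈ patch m a) : qAbs a x ^ 2 = qSq a x := Real.sq_sqrt (qSq_pos hx).le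

theorem sin_pos_of_mem_patch (hx : x ∈ patch m a) : 0 < Real.sin (x 2) :=
  Real.sin_pos_of_pos_of_lt_pi hx.2.2.1 hx.2.2.2

theorem Del_ne_zero (hx : x ∈ patch m a) : Del m a x ≠ 0 := hx.2.1

theorem SigSq_pos (hm : 0 ≤ m) (hx : x ∈ patch m a) : 0 < SigSq m a x := by
  have := hx.1
  have := qSq_pos hx
  unfold SigSq
  positivity

theorem isOpen_patch (m a : ℝ) : IsOpen (patch m a) := by
  have continuous_Del : Continuous (Del m a) := by
    unfold Del
    fun_prop
  exact (isOpen_lt continuous_const (continuous_apply 1)).inter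
    ((isOpen_ne_fun continuous_Del continuous_const).inter
      ((isOpen_lt continuous_const (continuous_apply 2)).inter
        (isOpen_lt (continuous_apply 2) continuous_const)))

theorem qSq_eq_sin (a : ℝ) (x : Pt) :
    qSq a x = x 1 ^ 2 + a ^ 2 - a ^ 2 * Real.sin (x 2) ^ 2 := by
  rw [qSq, Real.cos_sq']
  ring

theorem SigSq_eq (m a : ℝ) (x : Pt) :
    SigSq m a x = (x 1 ^ 2 + a ^ 2) ^ 2 - a ^ 2 * Real.sin (x 2) ^ 2 * Del m a x := by
  rw [SigSq, qSq_eq_sin, Del]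
  ring

/-- The 1-form `dt - a sin²θ dφ` of the Carter coframe, in which the Kerr metric is diagonal. -/
def carterTime (a : ℝ) (x : Pt) (V : Fin 4 → ℝ) : ℝ := V 0 - a * Real.sin (x 2) ^ 2 * V 3

/-- The 1-form `(r² + a²) dφ - a dt` of the Carter coframe. -/
def carterAngle (a : ℝ) (x : Pt) (V : Fin 4 → ℝ) : ℝ := (x 1 ^ 2 + a ^ 2) * V 3 - a * V 0

theorem kerr_isSymm (m a : ℝ) (x : Pt) : (kerr m a x).IsSymm :=
  Matrix.IsSymm.ext fun i j => by fin_cases i <;> fin_cases j <;> rfl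

theorem kerr_time_time (hm : 0 ≤ m) (hx : x ∈ patch m a) :
    kerr m a x 0 0 = (-Del m a x + a ^ 2 * Real.sin (x 2) ^ 2) / qSq a x := by
  have hS := (qSq_pos hx).ne'
  have hG := (SigSq_pos hm hx).ne'
  simp only [kerr, Matrix.of_apply, Matrix.cons_val]
  field_simp
  rw [SigSq_eq, qSq_eq_sin, Del]
  ring

theorem kerr_time_angle (hm : 0 ≤ m) (hx : x ∈ patch m a) :
    kerr m a x 0 3 =
      (Del m a x - (x 1 ^ 2 + a ^ 2)) * a * Real.sin (x 2) ^ 2 / qSq a x := by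
  have hG := (SigSq_pos hm hx).ne'
  simp only [kerr, Matrix.of_apply, Matrix.cons_val]
  field_simp
  rw [Del]
  ring

theorem ip_kerr (hm : 0 ≤ m) (hx : x ∈ patch m a) (X Y : VF) :
    ip (kerr m a) X Y x =
      -(Del m a x / qSq a x) * carterTime a x (X x) * carterTime a x (Y x)
        + Real.sin (x 2) ^ 2 / qSq a x * carterAngle a x (X x) * carterAngle a x (Y x)
        + qSq a x / Del m a x * X x 1 * Y x 1 + qSq a x * X x 2 * Y x 2 := by
  have components : ip (kerr m a) X Y x =
      kerr m a x 0 0 * X x 0 * Y x 0 + kerr m a x 0 3 * (X x 0 * Y x 3 + X x 3 * Y x 0) +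
        SigSq m a x * Real.sin (x 2) ^ 2 / qSq a x * X x 3 * Y x 3 +
        qSq a x / Del m a x * X x 1 * Y x 1 + qSq a x * X x 2 * Y x 2 := by
    simp only [ip, Fin.sum_univ_four, kerr, Matrix.of_apply, Matrix.cons_val]
    ring
  rw [components, kerr_time_time hm hx, kerr_time_angle hm hx, SigSq_eq, carterTime, carterTime,
    carterAngle, carterAngle]
  ring

theorem carterTime_frame (hx : x ∈ patch m a) (i : Fin 4) :
    carterTime a x (frame m a i x) = ![0, 0, 1, qSq a x / Del m a x] i := by
  have hS := (qSq_pos hx).ne'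
  have hQ := (qAbs_pos hx).ne'
  fin_cases i <;> simp only [carterTime, frame, Matrix.cons_val, Fin.reduceFinMk, Fin.zero_eta,
    Fin.mk_one]
  · ring
  · field_simp
    ring
  · field_simp
    rw [qSq_eq_sin]
  · rw [qSq_eq_sin]
    ring

theorem carterAngle_frame (hx : x ∈ patch m a) (i : Fin 4) :
    carterAngle a x (frame m a i x) = ![0, qAbs a x / Real.sin (x 2), 0, 0] i := by
  have hQ := (qAbs_pos hx).ne'
  have hs := (sin_pos_of_mem_patch hx).ne'
  fin_cases i <;> simp only [carterAngle, frame, Matrix.cons_val, Fin.reduceFinMk, Fin.zero_eta,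
    Fin.mk_one]
  · ring
  · field_simp
    rw [qAbs_sq hx, qSq_eq_sin]
  · ring
  · ring

theorem ip_frame (hm : 0 ≤ m) (hx : x ∈ patch m a) (i j : Fin 4) :
    ip (kerr m a) (frame m a i) (frame m a j) x = nullGram i j := by
  have hS := (qSq_pos hx).ne'
  have hQ := (qAbs_pos hx).ne'
  have hs := (sin_pos_of_mem_patch hx).ne'
  have hD := Del_ne_zero hx
  rw [ip_kerr hm hx, carterTime_frame hx, carterTime_frame hx, carterAngle_frame hx,
    carterAngle_frame hx, ← qAbs_sq hx]
  rw [← qAbs_sq hx] at hS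
  fin_cases i <;> fin_cases j <;>
    simp only [frame, nullGram, ← qAbs_sq hx, Matrix.of_apply, Matrix.cons_val, Fin.reduceFinMk,
      Fin.zero_eta, Fin.mk_one] <;>
    field_simp <;> ring

theorem differentiableAt_kerr (hm : 0 ≤ m) (hx : x ∈ patch m a) (μ ν : Fin 4) :
    DifferentiableAt ℝ (fun y => kerr m a y μ ν) x := by
  have hS := (qSq_pos hx).ne'
  have hG := (SigSq_pos hm hx).ne'
  have hD := Del_ne_zero hx
  have dS : DifferentiableAt ℝ (qSq a) x := by
    unfold qSq
    fun_prop
  have dD : DifferentiableAt ℝ (Del m a) x := by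
    unfold Del
    fun_prop
  have dG : DifferentiableAt ℝ (SigSq m a) x := by
    unfold SigSq
    fun_prop
  fin_cases μ <;> fin_cases ν <;>
    simp only [kerr, Matrix.of_apply, Matrix.cons_val, Fin.reduceFinMk, Fin.zero_eta,
      Fin.mk_one] <;>
    fun_prop (disch := assumption)

end KerrMetric

section FrameGradients

variable {m a : ℝ} {x : Pt}

theorem hasGrad_qSq (a : ℝ) (x : Pt) :
    HasGrad (qSq a) (2 * x 1) (-2 * a ^ 2 * Real.cos (x 2) * Real.sin (x 2)) x := by
  refine (((HasGrad.r x).pow 2).add ((HasGrad.const (a ^ 2) x).mul ((HasGrad.cos x).pow 2))).congr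
    (fun y => rfl) ?_ ?_ <;>
  · push_cast
    ring

theorem hasGrad_Del (m a : ℝ) (x : Pt) : HasGrad (Del m a) (2 * (x 1 - m)) 0 x := by
  refine ((((HasGrad.r x).pow 2).sub ((HasGrad.const (2 * m) x).mul (HasGrad.r x))).add
    (HasGrad.const (a ^ 2) x)).congr (fun y => rfl) ?_ ?_ <;>
  · push_cast
    ring

theorem hasGrad_qAbs (hx : x ∈ patch m a) :
    HasGrad (qAbs a) (x 1 / qAbs a x) (-a ^ 2 * Real.cos (x 2) * Real.sin (x 2) / qAbs a x) x := by
  have hQ := (qAbs_pos hx).ne'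
  refine ((hasGrad_qSq a x).comp (Real.hasDerivAt_sqrt (qSq_pos hx).ne')).congr
    (fun y => rfl) ?_ ?_ <;>
  · rw [← qAbs]
    field_simp

theorem hasGrad_radius (a : ℝ) (x : Pt) : HasGrad (fun y => y 1 ^ 2 + a ^ 2) (2 * x 1) 0 x := by
  refine (((HasGrad.r x).pow 2).add (HasGrad.const (a ^ 2) x)).congr (fun y => rfl) ?_ ?_ <;>
  · push_cast
    ring

theorem hasGrad_frame_zero (hx : x ∈ patch m a) :
    HasGrad (frame m a 0) ![0, 0, -x 1 / qAbs a x ^ 3, 0]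
      ![0, 0, a ^ 2 * Real.cos (x 2) * Real.sin (x 2) / qAbs a x ^ 3, 0] x := by
  have hQ := (qAbs_pos hx).ne'
  refine .vec (.const 0 x) (.const 0 x)
    (((HasGrad.const 1 x).div (hasGrad_qAbs hx) hQ).congr (fun y => rfl) ?_ ?_) (.const 0 x) <;>
  · field_simp
    ring

theorem hasGrad_frame_one (hx : x ∈ patch m a) :
    HasGrad (frame m a 1)
      ![-a * x 1 * Real.sin (x 2) / qAbs a x ^ 3, 0, 0, -x 1 / (qAbs a x ^ 3 * Real.sin (x 2))]
      ![a * Real.cos (x 2) * (qAbs a x ^ 2 + a ^ 2 * Real.sin (x 2) ^ 2) / qAbs a x ^ 3, 0, 0,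
        Real.cos (x 2) * (a ^ 2 * Real.sin (x 2) ^ 2 - qAbs a x ^ 2) /
          (qAbs a x ^ 3 * Real.sin (x 2) ^ 2)] x := by
  have hQ := (qAbs_pos hx).ne'
  have hs := (sin_pos_of_mem_patch hx).ne'
  refine .vec
    ((((HasGrad.const a x).mul (HasGrad.sin x)).div (hasGrad_qAbs hx) hQ).congr
      (fun y => rfl) ?_ ?_) (.const 0 x) (.const 0 x)
    (((HasGrad.const 1 x).div ((hasGrad_qAbs hx).mul (HasGrad.sin x)) (mul_ne_zero hQ hs)).congr
      (fun y => rfl) ?_ ?_) <;>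
  · field_simp
    ring

theorem hasGrad_frame_two (hx : x ∈ patch m a) :
    HasGrad (frame m a 2)
      ![2 * x 1 * (qSq a x - (x 1 ^ 2 + a ^ 2)) / qSq a x ^ 2,
        2 * (x 1 * Del m a x - (x 1 - m) * qSq a x) / qSq a x ^ 2, 0, -2 * a * x 1 / qSq a x ^ 2]
      ![2 * a ^ 2 * (x 1 ^ 2 + a ^ 2) * Real.cos (x 2) * Real.sin (x 2) / qSq a x ^ 2,
        -2 * a ^ 2 * Del m a x * Real.cos (x 2) * Real.sin (x 2) / qSq a x ^ 2, 0,
        2 * a ^ 3 * Real.cos (x 2) * Real.sin (x 2) / qSq a x ^ 2] x := by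
  have hS := (qSq_pos hx).ne'
  refine .vec
    (((hasGrad_radius a x).div (hasGrad_qSq a x) hS).congr (fun y => rfl) ?_ ?_)
    (((hasGrad_Del m a x).div (hasGrad_qSq a x) hS).neg.congr (fun y => rfl) ?_ ?_) (.const 0 x)
    (((HasGrad.const a x).div (hasGrad_qSq a x) hS).congr (fun y => rfl) ?_ ?_) <;>
  ring

theorem hasGrad_frame_three (hx : x ∈ patch m a) :
    HasGrad (frame m a 3)
      ![2 * (x 1 * Del m a x - (x 1 ^ 2 + a ^ 2) * (x 1 - m)) / Del m a x ^ 2, 0, 0,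
        -2 * a * (x 1 - m) / Del m a x ^ 2] 0 x := by
  have hD := Del_ne_zero hx
  refine (HasGrad.vec
    (((hasGrad_radius a x).div (hasGrad_Del m a x) hD).congr (fun y => rfl) ?_ rfl)
    (.const 1 x) (.const 0 x)
    (((HasGrad.const a x).div (hasGrad_Del m a x) hD).congr (fun y => rfl) ?_ rfl)).congr
      (fun y => rfl) rfl ?_
  · ring
  · ring
  · ext l
    fin_cases l <;> simp

theorem differentiableAt_frame (hx : x ∈ patch m a) (i : Fin 4) :
    DifferentiableAt ℝ (frame m a i) x := by
  fin_cases i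
  exacts [(hasGrad_frame_zero hx).differentiableAt, (hasGrad_frame_one hx).differentiableAt,
    (hasGrad_frame_two hx).differentiableAt, (hasGrad_frame_three hx).differentiableAt]

theorem isRigidFrameAt_kerr (hm : 0 ≤ m) (hx : x ∈ patch m a) :
    IsRigidFrameAt (kerr m a) (frame m a) nullGram x where
  isSymm := kerr_isSymm m a
  isUnit_det := isUnit_det_nullGram
  gram := Filter.eventually_of_mem ((isOpen_patch m a).mem_nhds hx) fun _ hy => ip_frame hm hy
  differentiableAt_metric := differentiableAt_kerr hm hx
  differentiableAt_frame := differentiableAt_frame hx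

end FrameGradients

/-! ### The connection of the Kerr metric -/

section Connection

variable (m a : ℝ)

/-- The expansion `r/|q|²`, equal to `½ tr χ`. -/
def expansion (x : Pt) : ℝ := x 1 / qSq a x

/-- The twist `a cos θ/|q|²`, equal to `½ ⁽ᵃ⁾tr χ`. -/
def twist (x : Pt) : ℝ := a * Real.cos (x 2) / qSq a x

/-- The ratio `Δ/|q|²`, by which the roles of `e_3` and `e_4` differ. -/
def delRatio (x : Pt) : ℝ := Del m a x / qSq a x

/-- The value `½ ∂_r(Δ/|q|²)` of `ω̲`. -/
def ombKerr (x : Pt) : ℝ := (x 1 - m) / qSq a x - x 1 * Del m a x / qSq a x ^ 2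

/-- The value `a² cos θ sin θ/|q|³` of `ζ_1`. -/
def zetaOne (x : Pt) : ℝ := a ^ 2 * Real.cos (x 2) * Real.sin (x 2) / qAbs a x ^ 3

/-- The value `a r sin θ/|q|³` of `ζ_2`. -/
def zetaTwo (x : Pt) : ℝ := a * x 1 * Real.sin (x 2) / qAbs a x ^ 3

/-- The skew-symmetric matrix with the given entries above the diagonal. -/
def skew (p q r s t u : ℝ) : Matrix (Fin 4) (Fin 4) ℝ :=
  !![0, p, q, r; -p, 0, s, t; -q, -s, 0, u; -r, -t, -u, 0]

/-- The connection coefficients `g(D_i e_j, e_k)` of the principal frame, as matrices in `(j, k)`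
indexed by `i`. -/
def ricci (x : Pt) : Fin 4 → Fin 4 → Fin 4 → ℝ :=
  let A := expansion a x
  let B := twist a x
  let D := delRatio m a x
  let U := zetaOne a x
  let W := zetaTwo a x
  ![skew 0 (D * A) (-A) (-(D * B)) (-B) (-(2 * U)),
    skew (Lam a x) (D * B) B (D * A) (-A) (-(2 * W)),
    skew (D * B) 0 (2 * U) 0 (-(2 * W)) (4 * ombKerr m a x),
    skew B (2 * U) 0 (2 * W) 0 0]

variable {m a} {x : Pt}

theorem HasGrad.bracket {X Y : VF} {Xr Xθ Yr Yθ : Fin 4 → ℝ} (HX : HasGrad X Xr Xθ x)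
    (HY : HasGrad Y Yr Yθ x) :
    bracket X Y x = X x 1 • Yr + X x 2 • Yθ - (Y x 1 • Xr + Y x 2 • Xθ) := by
  rw [bracket_eq HX.differentiableAt HY.differentiableAt, HX.along, HY.along]

theorem bracket_frame_zero_one (hx : x ∈ patch m a) :
    bracket (frame m a 0) (frame m a 1) x =
      ∑ k, ![0, -Lam a x, twist a x, delRatio m a x * twist a x] k • frame m a k x := by
  have hQ := (qAbs_pos hx).ne'
  have hs := (sin_pos_of_mem_patch hx).ne'
  have hD := Del_ne_zero hx
  have hQs := (qAbs_sq hx).trans (qSq_eq_sin a x)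
  rw [(hasGrad_frame_zero hx).bracket (hasGrad_frame_one hx)]
  ext l
  fin_cases l <;> simp only [Fin.sum_univ_four, frame, twist, delRatio, Lam,
    Real.cot_eq_cos_div_sin, ← qAbs_sq hx, Pi.add_apply, Pi.sub_apply, Pi.smul_apply, smul_eq_mul,
    Matrix.cons_val, Fin.reduceFinMk, Fin.zero_eta, Fin.mk_one]
  · field_simp
    linear_combination a * Real.cos (x 2) * hQs
  · field_simp
    ring
  · ring
  · field_simp
    linear_combination -Real.cos (x 2) * hQs

theorem bracket_frame_zero_two (hx : x ∈ patch m a) :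
    bracket (frame m a 0) (frame m a 2) x =
      ∑ k, ![-(delRatio m a x * expansion a x), 0, 2 * zetaOne a x, 0] k • frame m a k x := by
  have hQ := (qAbs_pos hx).ne'
  rw [(hasGrad_frame_zero hx).bracket (hasGrad_frame_two hx)]
  ext l
  fin_cases l <;> simp only [Fin.sum_univ_four, frame, expansion, delRatio, zetaOne, ← qAbs_sq hx,
    Pi.add_apply, Pi.sub_apply, Pi.smul_apply, smul_eq_mul, Matrix.cons_val, Fin.reduceFinMk,
    Fin.zero_eta, Fin.mk_one] <;>
  · field_simp
    ring

theorem bracket_frame_zero_three (hx : x ∈ patch m a) :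
    bracket (frame m a 0) (frame m a 3) x = ∑ k, ![expansion a x, 0, 0, 0] k • frame m a k x := by
  have hQ := (qAbs_pos hx).ne'
  rw [(hasGrad_frame_zero hx).bracket (hasGrad_frame_three hx)]
  ext l
  fin_cases l <;> simp only [Fin.sum_univ_four, frame, expansion, ← qAbs_sq hx, Pi.add_apply,
    Pi.sub_apply, Pi.smul_apply, Pi.zero_apply, smul_eq_mul, Matrix.cons_val, Fin.reduceFinMk,
    Fin.zero_eta, Fin.mk_one] <;>
  · field_simp
    ring

theorem bracket_frame_one_two (hx : x ∈ patch m a) :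
    bracket (frame m a 1) (frame m a 2) x =
      ∑ k, ![0, -(delRatio m a x * expansion a x), 0, 0] k • frame m a k x := by
  have hQ := (qAbs_pos hx).ne'
  have hs := (sin_pos_of_mem_patch hx).ne'
  rw [(hasGrad_frame_one hx).bracket (hasGrad_frame_two hx)]
  ext l
  fin_cases l <;> simp only [Fin.sum_univ_four, frame, expansion, delRatio, ← qAbs_sq hx,
    Pi.add_apply, Pi.sub_apply, Pi.smul_apply, smul_eq_mul, Matrix.cons_val, Fin.reduceFinMk,
    Fin.zero_eta, Fin.mk_one] <;>
  · field_simp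
    ring

theorem bracket_frame_one_three (hx : x ∈ patch m a) :
    bracket (frame m a 1) (frame m a 3) x = ∑ k, ![0, expansion a x, 0, 0] k • frame m a k x := by
  have hQ := (qAbs_pos hx).ne'
  have hs := (sin_pos_of_mem_patch hx).ne'
  rw [(hasGrad_frame_one hx).bracket (hasGrad_frame_three hx)]
  ext l
  fin_cases l <;> simp only [Fin.sum_univ_four, frame, expansion, ← qAbs_sq hx, Pi.add_apply,
    Pi.sub_apply, Pi.smul_apply, Pi.zero_apply, smul_eq_mul, Matrix.cons_val, Fin.reduceFinMk,
    Fin.zero_eta, Fin.mk_one] <;>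
  · field_simp
    ring

theorem bracket_frame_two_three (hx : x ∈ patch m a) :
    bracket (frame m a 2) (frame m a 3) x =
      ∑ k, ![0, 4 * zetaTwo a x, 0, 2 * ombKerr m a x] k • frame m a k x := by
  have hQ := (qAbs_pos hx).ne'
  have hs := (sin_pos_of_mem_patch hx).ne'
  have hD := Del_ne_zero hx
  have hQs := (qAbs_sq hx).trans (qSq_eq_sin a x)
  rw [(hasGrad_frame_two hx).bracket (hasGrad_frame_three hx)]
  ext l
  fin_cases l <;> simp only [Fin.sum_univ_four, frame, zetaTwo, ombKerr, ← qAbs_sq hx, Pi.add_apply,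
    Pi.sub_apply, Pi.smul_apply, Pi.zero_apply, smul_eq_mul, Matrix.cons_val, Fin.reduceFinMk,
    Fin.zero_eta, Fin.mk_one]
  · field_simp
    linear_combination -4 * Del m a x * x 1 * hQs
  · field_simp
    ring
  · ring
  · field_simp
    ring

theorem skew_antisymm (p q r s t u : ℝ) (j k : Fin 4) :
    skew p q r s t u j k = -skew p q r s t u k j := by
  fin_cases j <;> fin_cases k <;> simp [skew]

theorem ricci_antisymm (m a : ℝ) (x : Pt) (i j k : Fin 4) :
    ricci m a x i j k = -ricci m a x i k j := by
  fin_cases i <;> exact skew_antisymm _ _ _ _ _ _ j k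

theorem ip_sum_frame (hm : 0 ≤ m) (hx : x ∈ patch m a) {V : VF} {c : Fin 4 → ℝ}
    (hV : V x = ∑ k, c k • frame m a k x) (j : Fin 4) :
    ip (kerr m a) V (frame m a j) x = ![c 0, c 1, -2 * c 3, -2 * c 2] j := by
  rw [ip_sum_smul_left hV]
  fin_cases j <;> simp [ip_frame hm hx, nullGram, Fin.sum_univ_four, mul_comm]

theorem ip_bracket_frame_of_lt (hm : 0 ≤ m) (hx : x ∈ patch m a) {i j : Fin 4} (hij : i < j)
    (k : Fin 4) :
    ip (kerr m a) (bracket (frame m a i) (frame m a j)) (frame m a k) x =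
      ricci m a x i j k - ricci m a x j i k := by
  fin_cases i <;> fin_cases j <;> try exact absurd hij (by decide)
  · refine (ip_sum_frame hm hx (bracket_frame_zero_one hx) k).trans ?_
    fin_cases k <;> simp only [ricci, skew, Matrix.of_apply, Matrix.cons_val, Fin.zero_eta,
      Fin.mk_one, Fin.reduceFinMk] <;> ring
  · refine (ip_sum_frame hm hx (bracket_frame_zero_two hx) k).trans ?_
    fin_cases k <;> simp only [ricci, skew, Matrix.of_apply, Matrix.cons_val, Fin.zero_eta,
      Fin.mk_one, Fin.reduceFinMk] <;> ring
  · refine (ip_sum_frame hm hx (bracket_frame_zero_three hx) k).trans ?_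
    fin_cases k <;> simp [ricci, skew]
  · refine (ip_sum_frame hm hx (bracket_frame_one_two hx) k).trans ?_
    fin_cases k <;> simp [ricci, skew]
  · refine (ip_sum_frame hm hx (bracket_frame_one_three hx) k).trans ?_
    fin_cases k <;> simp [ricci, skew]
  · refine (ip_sum_frame hm hx (bracket_frame_two_three hx) k).trans ?_
    fin_cases k <;> simp only [ricci, skew, Matrix.of_apply, Matrix.cons_val, Fin.zero_eta,
      Fin.mk_one, Fin.reduceFinMk] <;> ring

theorem ip_bracket_frame (hm : 0 ≤ m) (hx : x ∈ patch m a) (i j k : Fin 4) :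
    ip (kerr m a) (bracket (frame m a i) (frame m a j)) (frame m a k) x =
      ricci m a x i j k - ricci m a x j i k := by
  have antisymm := ip_sub_left (g := kerr m a) (V := bracket (frame m a i) (frame m a j))
    (X := 0) (Y := bracket (frame m a j) (frame m a i)) (x := x)
    (by ext l; simp [bracket]) (frame m a k)
  have ip_zero : ip (kerr m a) 0 (frame m a k) x = 0 := by simp [ip]
  rcases lt_trichotomy i j with hij | rfl | hji
  · exact ip_bracket_frame_of_lt hm hx hij k
  · linarith
  · linarith [ip_bracket_frame_of_lt hm hx hji k]

theorem ip_covD_kerr (hm : 0 ≤ m) (hx : x ∈ patch m a) (i j k : Fin 4) :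
    ip (kerr m a) (covD (kerr m a) (frame m a i) (frame m a j)) (frame m a k) x =
      ricci m a x i j k :=
  (isRigidFrameAt_kerr hm hx).ip_covD_eq_of_ip_bracket (ricci_antisymm m a x)
    (ip_bracket_frame hm hx) i j k

end Connection

section Curvature

variable {m a : ℝ} {x : Pt}

theorem HasGrad.along_frame {F : Type*} [NormedAddCommGroup F] [NormedSpace ℝ F] {f : Pt → F}
    {u v : F} (H : HasGrad f u v x) (i : Fin 4) :
    KerrTeukolsky.along (frame m a i) f x = ![(1 / qAbs a x) • v, 0, -delRatio m a x • u, u] i := by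
  rw [H.along]
  fin_cases i <;> simp [frame, delRatio]

theorem hasGrad_expansion (hx : x ∈ patch m a) : HasGrad (expansion a)
    (1 / qSq a x - 2 * x 1 ^ 2 / qSq a x ^ 2)
    (2 * x 1 * a ^ 2 * Real.cos (x 2) * Real.sin (x 2) / qSq a x ^ 2) x := by
  have hS := (qSq_pos hx).ne'
  refine ((HasGrad.r x).div (hasGrad_qSq a x) hS).congr (fun y => rfl) ?_ ?_
  · field_simp
  · ring

theorem hasGrad_twist (hx : x ∈ patch m a) : HasGrad (twist a)
    (-2 * a * Real.cos (x 2) * x 1 / qSq a x ^ 2)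
    (a * Real.sin (x 2) * (2 * a ^ 2 * Real.cos (x 2) ^ 2 - qSq a x) / qSq a x ^ 2) x := by
  have hS := (qSq_pos hx).ne'
  refine (((HasGrad.const a x).mul (HasGrad.cos x)).div (hasGrad_qSq a x) hS).congr
    (fun y => rfl) ?_ ?_ <;>
  · field_simp
    ring

theorem hasGrad_delRatio (hx : x ∈ patch m a) : HasGrad (delRatio m a) (2 * ombKerr m a x)
    (2 * Del m a x * a ^ 2 * Real.cos (x 2) * Real.sin (x 2) / qSq a x ^ 2) x := by
  have hS := (qSq_pos hx).ne'
  refine ((hasGrad_Del m a x).div (hasGrad_qSq a x) hS).congr (fun y => rfl) ?_ ?_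
  · rw [ombKerr]
    field_simp
  · ring

theorem hasGrad_ombKerr (hx : x ∈ patch m a) : HasGrad (ombKerr m a)
    (1 / qSq a x - 4 * x 1 * (x 1 - m) / qSq a x ^ 2 - Del m a x / qSq a x ^ 2
      + 4 * x 1 ^ 2 * Del m a x / qSq a x ^ 3)
    (2 * (x 1 - m) * a ^ 2 * Real.cos (x 2) * Real.sin (x 2) / qSq a x ^ 2
      - 4 * x 1 * Del m a x * a ^ 2 * Real.cos (x 2) * Real.sin (x 2) / qSq a x ^ 3) x := by
  have hS := (qSq_pos hx).ne'
  refine ((((HasGrad.r x).sub (HasGrad.const m x)).div (hasGrad_qSq a x) hS).sub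
    (((HasGrad.r x).mul (hasGrad_Del m a x)).div ((hasGrad_qSq a x).pow 2)
      (pow_ne_zero 2 hS))).congr (fun y => rfl) ?_ ?_ <;>
  · push_cast
    field_simp
    ring

theorem hasGrad_zetaOne (hx : x ∈ patch m a) : HasGrad (zetaOne a)
    (-3 * x 1 * a ^ 2 * Real.cos (x 2) * Real.sin (x 2) / qAbs a x ^ 5)
    (a ^ 2 * (Real.cos (x 2) ^ 2 - Real.sin (x 2) ^ 2) / qAbs a x ^ 3 +
      3 * a ^ 4 * Real.cos (x 2) ^ 2 * Real.sin (x 2) ^ 2 / qAbs a x ^ 5) x := by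
  have hQ := (qAbs_pos hx).ne'
  refine ((((HasGrad.const (a ^ 2) x).mul (HasGrad.cos x)).mul (HasGrad.sin x)).div
    ((hasGrad_qAbs hx).pow 3) (pow_ne_zero 3 hQ)).congr (fun y => rfl) ?_ ?_ <;>
  · push_cast
    field_simp
    ring

theorem hasGrad_zetaTwo (hx : x ∈ patch m a) : HasGrad (zetaTwo a)
    (a * Real.sin (x 2) / qAbs a x ^ 3 - 3 * a * x 1 ^ 2 * Real.sin (x 2) / qAbs a x ^ 5)
    (a * x 1 * Real.cos (x 2) / qAbs a x ^ 3 +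
      3 * a ^ 3 * x 1 * Real.cos (x 2) * Real.sin (x 2) ^ 2 / qAbs a x ^ 5) x := by
  have hQ := (qAbs_pos hx).ne'
  refine ((((HasGrad.const a x).mul (HasGrad.r x)).mul (HasGrad.sin x)).div
    ((hasGrad_qAbs hx).pow 3) (pow_ne_zero 3 hQ)).congr (fun y => rfl) ?_ ?_ <;>
  · push_cast
    field_simp
    ring

theorem hasGrad_Lam (hx : x ∈ patch m a) : HasGrad (Lam a)
    (2 * x 1 * Real.cos (x 2) / (qAbs a x ^ 3 * Real.sin (x 2))
      - 3 * x 1 * (x 1 ^ 2 + a ^ 2) * Real.cos (x 2) / (qAbs a x ^ 5 * Real.sin (x 2)))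
    ((x 1 ^ 2 + a ^ 2) * (-1 / (qAbs a x ^ 3 * Real.sin (x 2) ^ 2)
      + 3 * a ^ 2 * Real.cos (x 2) ^ 2 / qAbs a x ^ 5)) x := by
  have hQ := (qAbs_pos hx).ne'
  have hs := (sin_pos_of_mem_patch hx).ne'
  refine (((hasGrad_radius a x).div ((hasGrad_qAbs hx).pow 3) (pow_ne_zero 3 hQ)).mul
    ((HasGrad.cos x).div (HasGrad.sin x) hs)).congr
      (fun y => by rw [Lam, Real.cot_eq_cos_div_sin]) ?_ ?_
  · push_cast
    field_simp
    ring
  · push_cast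
    field_simp
    linear_combination (-qAbs a x ^ 2 * (x 1 ^ 2 + a ^ 2)) * Real.sin_sq_add_cos_sq (x 2)

theorem differentiableAt_ricci (hx : x ∈ patch m a) (i j k : Fin 4) :
    DifferentiableAt ℝ (fun y => ricci m a y i j k) x := by
  have dA := (hasGrad_expansion hx).differentiableAt
  have dB := (hasGrad_twist hx).differentiableAt
  have dD := (hasGrad_delRatio hx).differentiableAt
  have dO := (hasGrad_ombKerr hx).differentiableAt
  have dU := (hasGrad_zetaOne hx).differentiableAt
  have dW := (hasGrad_zetaTwo hx).differentiableAt
  have dL := (hasGrad_Lam hx).differentiableAt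
  fin_cases i <;> fin_cases j <;> fin_cases k <;>
    simp only [ricci, skew, Matrix.of_apply, Matrix.cons_val, Fin.reduceFinMk, Fin.zero_eta,
      Fin.mk_one] <;>
    fun_prop

theorem trChi_kerr (hm : 0 ≤ m) (hx : x ∈ patch m a) :
    trChi (kerr m a) (frame m a) x = 2 * expansion a x := by
  simp only [trChi, chi, Fin.sum_univ_two, ip_covD_kerr hm hx, ricci, skew, hz, Matrix.of_apply,
    Matrix.cons_val]
  ring

theorem atrChi_kerr (hm : 0 ≤ m) (hx : x ∈ patch m a) :
    atrChi (kerr m a) (frame m a) x = 2 * twist a x := by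
  simp only [atrChi, chi, Fin.sum_univ_two, ip_covD_kerr hm hx, ricci, skew, hz, eps,
    Matrix.of_apply, Matrix.cons_val]
  ring

theorem trChib_kerr (hm : 0 ≤ m) (hx : x ∈ patch m a) :
    trChib (kerr m a) (frame m a) x = -2 * delRatio m a x * expansion a x := by
  simp only [trChib, chib, Fin.sum_univ_two, ip_covD_kerr hm hx, ricci, skew, hz, Matrix.of_apply,
    Matrix.cons_val]
  ring

theorem atrChib_kerr (hm : 0 ≤ m) (hx : x ∈ patch m a) :
    atrChib (kerr m a) (frame m a) x = 2 * delRatio m a x * twist a x := by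
  simp only [atrChib, chib, Fin.sum_univ_two, ip_covD_kerr hm hx, ricci, skew, hz, eps,
    Matrix.of_apply, Matrix.cons_val]
  ring

theorem eta_kerr (hm : 0 ≤ m) (hx : x ∈ patch m a) (b : Fin 2) :
    eta (kerr m a) (frame m a) b x = ![-zetaOne a x, zetaTwo a x] b := by
  fin_cases b <;> simp [eta, ip_covD_kerr hm hx, ricci, skew, hz]

theorem etab_kerr (hm : 0 ≤ m) (hx : x ∈ patch m a) (b : Fin 2) :
    etab (kerr m a) (frame m a) b x = ![-zetaOne a x, -zetaTwo a x] b := by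
  fin_cases b <;> simp [etab, ip_covD_kerr hm hx, ricci, skew, hz]

theorem zeta_kerr (hm : 0 ≤ m) (hx : x ∈ patch m a) (b : Fin 2) :
    zeta (kerr m a) (frame m a) b x = ![zetaOne a x, zetaTwo a x] b := by
  fin_cases b <;> simp [zeta, ip_covD_kerr hm hx, ricci, skew, hz]

theorem om_kerr (hm : 0 ≤ m) (hx : x ∈ patch m a) : om (kerr m a) (frame m a) x = 0 := by
  simp [om, ip_covD_kerr hm hx, ricci, skew]

theorem omb_kerr (hm : 0 ≤ m) (hx : x ∈ patch m a) :
    omb (kerr m a) (frame m a) x = ombKerr m a x := by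
  simp [omb, ip_covD_kerr hm hx, ricci, skew]

theorem hconn_kerr (hm : 0 ≤ m) (hx : x ∈ patch m a) (i : Fin 4) :
    hconn (kerr m a) (frame m a) (frame m a i) 0 1 x =
      ![0, Lam a x, delRatio m a x * twist a x, twist a x] i := by
  simp only [hconn, ip_covD_kerr hm hx]
  fin_cases i <;> simp [ricci, skew, hz]

theorem eventually_mem_patch (hx : x ∈ patch m a) : ∀ᶠ y in 𝓝 x, y ∈ patch m a :=
  (isOpen_patch m a).mem_nhds hx

theorem riem_kerr (hm : 0 ≤ m) (hx : x ∈ patch m a) (w z i j : Fin 4) :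
    riem (kerr m a) (frame m a w) (frame m a z) (frame m a i) (frame m a j) x =
      along (frame m a i) (fun y => ricci m a y j z w) x
      - along (frame m a j) (fun y => ricci m a y i z w) x
      + ∑ k, nullGram⁻¹.mulVec (ricci m a x j z) k * ricci m a x i k w
      - ∑ k, nullGram⁻¹.mulVec (ricci m a x i z) k * ricci m a x j k w
      - ∑ k, nullGram⁻¹.mulVec (ricci m a x i j - ricci m a x j i) k * ricci m a x k z w :=
  (isRigidFrameAt_kerr hm hx).riem_eq
    ((eventually_mem_patch hx).mono fun _ hy => ip_covD_kerr hm hy)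
    (differentiableAt_ricci hx) w z i j

theorem rho_kerr (hm : 0 ≤ m) (hx : x ∈ patch m a) :
    rho (kerr m a) (frame m a) x =
      along (frame m a 3) (ombKerr m a) x + zetaOne a x ^ 2 - 3 * zetaTwo a x ^ 2 := by
  have along_four := along_const_mul (frame m a 3) 4 (hasGrad_ombKerr hx).differentiableAt
  have along_zero := along_const (frame m a 2) (0 : ℝ) x
  rw [rho, riem_kerr hm hx]
  simp only [ricci, skew, Fin.sum_univ_four, nullGram_inv_mulVec, Matrix.of_apply,
    Matrix.cons_val, Pi.sub_apply, along_four, along_zero]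
  ring

theorem rhoDual_kerr (hm : 0 ≤ m) (hx : x ∈ patch m a) :
    rhoDual (kerr m a) (frame m a) x =
      delRatio m a x * along (frame m a 3) (twist a) x + 2 * ombKerr m a x * twist a x +
        2 * zetaTwo a x * (zetaOne a x + Lam a x) := by
  have hB := hasGrad_twist hx
  have along_neg_twist := hB.neg.along_frame (m := m) (a := a) 2
  have along_neg_mul := ((hasGrad_delRatio hx).mul hB).neg.along_frame (m := m) (a := a) 3
  rw [rhoDual, riem_kerr hm hx, hB.along_frame]
  simp only [ricci, skew, Fin.sum_univ_four, nullGram_inv_mulVec, Matrix.of_apply,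
    Matrix.cons_val, Pi.sub_apply, smul_eq_mul] at along_neg_twist along_neg_mul ⊢
  rw [along_neg_twist, along_neg_mul]
  ring

theorem along_zetaTwo (hx : x ∈ patch m a) :
    along (frame m a 0) (zetaTwo a) x = zetaTwo a x * (Lam a x + 2 * zetaOne a x) := by
  have hQ := (qAbs_pos hx).ne'
  have hs := (sin_pos_of_mem_patch hx).ne'
  have hQs := (qAbs_sq hx).trans (qSq_eq_sin a x)
  rw [(hasGrad_zetaTwo hx).along_frame]
  simp only [zetaTwo, zetaOne, Lam, Real.cot_eq_cos_div_sin, Matrix.cons_val, smul_eq_mul]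
  field_simp
  linear_combination (a * x 1 * Real.cos (x 2)) * hQs

theorem rho_kerr_eq_along_Lam (hm : 0 ≤ m) (hx : x ∈ patch m a) :
    rho (kerr m a) (frame m a) x = along (frame m a 0) (Lam a) x + Lam a x ^ 2 +
      delRatio m a x * (expansion a x ^ 2 - 3 * twist a x ^ 2) := by
  have hQ := (qAbs_pos hx).ne'
  have hs := (sin_pos_of_mem_patch hx).ne'
  have hQc : qAbs a x ^ 2 = x 1 ^ 2 + a ^ 2 * Real.cos (x 2) ^ 2 := qAbs_sq hx
  rw [rho_kerr hm hx, (hasGrad_ombKerr hx).along_frame, (hasGrad_Lam hx).along_frame]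
  simp only [zetaTwo, zetaOne, Lam, Real.cot_eq_cos_div_sin, delRatio, expansion, twist,
    Matrix.cons_val, smul_eq_mul, ← qAbs_sq hx]
  field_simp
  simp only [hQc, Real.sin_sq, Del]
  ring

end Curvature

/-! ### The Teukolsky operator of the Kerr metric -/

section Wave

variable {m a : ℝ} {x : Pt} {f : Pt → ℂ}

theorem along_frame_zero_one_comm (hx : x ∈ patch m a) (hf : ContDiffAt ℝ 2 f x) :
    along (frame m a 0) (along (frame m a 1) f) x - along (frame m a 1) (along (frame m a 0) f) x =
      -Lam a x * along (frame m a 1) f x + twist a x * along (frame m a 2) f x +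
        delRatio m a x * twist a x * along (frame m a 3) f x := by
  rw [← along_bracket hf (differentiableAt_frame hx 0) (differentiableAt_frame hx 1),
    along_sum_smul (bracket_frame_zero_one hx)]
  simp only [Fin.sum_univ_four, Matrix.cons_val, Complex.real_smul]
  push_cast
  ring

theorem along_frame_two_three_comm (hx : x ∈ patch m a) (hf : ContDiffAt ℝ 2 f x) :
    along (frame m a 2) (along (frame m a 3) f) x - along (frame m a 3) (along (frame m a 2) f) x =
      4 * zetaTwo a x * along (frame m a 1) f x + 2 * ombKerr m a x * along (frame m a 3) f x := by
  rw [← along_bracket hf (differentiableAt_frame hx 2) (differentiableAt_frame hx 3),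
    along_sum_smul (bracket_frame_two_three hx)]
  simp only [Fin.sum_univ_four, Matrix.cons_val, Complex.real_smul]
  push_cast
  ring

theorem box_kerr (hm : 0 ≤ m) (hx : x ∈ patch m a) (hf : ContDiffAt ℝ 2 f x) :
    box (kerr m a) f x =
      along (frame m a 0) (along (frame m a 0) f) x + along (frame m a 1) (along (frame m a 1) f) x
      - along (frame m a 3) (along (frame m a 2) f) x
      + (Lam a x - 2 * zetaOne a x) * along (frame m a 0) f x
      - 2 * zetaTwo a x * along (frame m a 1) f x - expansion a x * along (frame m a 2) f x
      + delRatio m a x * expansion a x * along (frame m a 3) f x := by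
  have H := isRigidFrameAt_kerr hm hx
  rw [H.box_eq hf, sum_nullGram_inv_smul]
  simp only [H.along_covD (ip_covD_kerr hm hx), nullGram_inv_mulVec, Fin.sum_univ_four, ricci,
    skew, Matrix.of_apply, Matrix.cons_val, Complex.real_smul]
  push_cast
  linear_combination (-1 / 2) * along_frame_two_three_comm hx hf

/-- The zeroth order coefficient of `⁽ᶜ⁾∇_3` on the scalar component of a tensor of conformal
type `2`. -/
def nablaThreeCoeff (m a : ℝ) (x : Pt) : ℂ :=
  2 * Complex.I * (delRatio m a x * twist a x : ℝ) - 4 * (ombKerr m a x : ℝ)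

/-- The zeroth order coefficient of the divergence `⁽ᶜ⁾𝒟̄ ·` on the scalar component of a tensor of
conformal type `2`, up to the factor `2` of its principal part. -/
def divCoeff (a : ℝ) (x : Pt) : ℂ :=
  2 * (zetaOne a x : ℝ) + 2 * (Lam a x : ℝ) - 2 * Complex.I * (zetaTwo a x : ℝ)

theorem differentiableAt_nablaThreeCoeff (hx : x ∈ patch m a) :
    DifferentiableAt ℝ (nablaThreeCoeff m a) x := by
  have hD := (hasGrad_delRatio hx).differentiableAt
  have hB := (hasGrad_twist hx).differentiableAt
  have hO := (hasGrad_ombKerr hx).differentiableAt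
  unfold nablaThreeCoeff
  fun_prop

theorem differentiableAt_divCoeff (hx : x ∈ patch m a) : DifferentiableAt ℝ (divCoeff a) x := by
  have hU := (hasGrad_zetaOne hx).differentiableAt
  have hW := (hasGrad_zetaTwo hx).differentiableAt
  have hL := (hasGrad_Lam hx).differentiableAt
  unfold divCoeff
  fun_prop

theorem along_three_nablaThreeCoeff (hm : 0 ≤ m) (hx : x ∈ patch m a) :
    along (frame m a 3) (nablaThreeCoeff m a) x =
      2 * Complex.I * (rhoDual (kerr m a) (frame m a) x
        - 2 * zetaTwo a x * (zetaOne a x + Lam a x))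
      - 4 * (rho (kerr m a) (frame m a) x - zetaOne a x ^ 2 + 3 * zetaTwo a x ^ 2) := by
  have hD := (hasGrad_delRatio hx).differentiableAt
  have hB := (hasGrad_twist hx).differentiableAt
  have hO := (hasGrad_ombKerr hx).differentiableAt
  have along_delRatio : along (frame m a 3) (delRatio m a) x = 2 * ombKerr m a x :=
    (hasGrad_delRatio hx).along_frame 3
  unfold nablaThreeCoeff
  rw [along_sub _ (by fun_prop) (by fun_prop), along_const_mul _ _ (by fun_prop),
    along_const_mul _ _ (by fun_prop), along_ofReal _ (by fun_prop), along_ofReal _ hO,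
    along_mul _ hD hB, along_delRatio, rhoDual_kerr hm hx, rho_kerr hm hx]
  push_cast
  ring

theorem along_zero_divCoeff (hm : 0 ≤ m) (hx : x ∈ patch m a) :
    along (frame m a 0) (divCoeff a) x =
      2 * along (frame m a 0) (zetaOne a) x
      + 2 * (rho (kerr m a) (frame m a) x - Lam a x ^ 2
        - delRatio m a x * (expansion a x ^ 2 - 3 * twist a x ^ 2))
      - 2 * Complex.I * (zetaTwo a x * (Lam a x + 2 * zetaOne a x)) := by
  have hU := (hasGrad_zetaOne hx).differentiableAt
  have hW := (hasGrad_zetaTwo hx).differentiableAt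
  have hL := (hasGrad_Lam hx).differentiableAt
  unfold divCoeff
  rw [along_sub _ (by fun_prop) (by fun_prop), along_add _ (by fun_prop) (by fun_prop),
    along_const_mul _ _ (by fun_prop), along_const_mul _ _ (by fun_prop),
    along_const_mul _ _ (by fun_prop), along_ofReal _ hU, along_ofReal _ hL, along_ofReal _ hW,
    along_zetaTwo hx, rho_kerr_eq_along_Lam hm hx]
  push_cast
  ring

theorem along_one_divCoeff (hx : x ∈ patch m a) : along (frame m a 1) (divCoeff a) x = 0 := by
  have hU := hasGrad_zetaOne hx
  have hW := hasGrad_zetaTwo hx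
  have hL := hasGrad_Lam hx
  exact ((((HasGrad.const 2 x).mul hU.ofReal).add ((HasGrad.const 2 x).mul hL.ofReal)).sub
    ((HasGrad.const (2 * Complex.I) x).mul hW.ofReal)).along_frame 1

theorem spinD_frame (hm : 0 ≤ m) (hx : x ∈ patch m a) (k : ℕ) (i : Fin 4) :
    spinD (kerr m a) (frame m a) k (frame m a i) f x = along (frame m a i) f x +
      k * Complex.I * (![0, Lam a x, delRatio m a x * twist a x, twist a x] i : ℝ) * f x := by
  rw [spinD, hconn_kerr hm hx]

theorem spin3_kerr (hm : 0 ≤ m) (hx : x ∈ patch m a) :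
    spin3 (kerr m a) (frame m a) 2 f x =
      along (frame m a 2) f x + nablaThreeCoeff m a x * f x := by
  rw [spin3, spinD_frame hm hx, omb_kerr hm hx, nablaThreeCoeff]
  simp only [Matrix.cons_val]
  push_cast
  ring

theorem spin4_kerr (hm : 0 ≤ m) (hx : x ∈ patch m a) (s : ℝ) :
    spin4 (kerr m a) (frame m a) s f x =
      along (frame m a 3) f x + 2 * Complex.I * twist a x * f x := by
  rw [spin4, spinD_frame hm hx, om_kerr hm hx]
  simp only [Matrix.cons_val]
  push_cast
  ring

theorem spinH_kerr_zero (hm : 0 ≤ m) (hx : x ∈ patch m a) (k : ℕ) (s : ℝ) :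
    spinH (kerr m a) (frame m a) k s 0 f x =
      along (frame m a 0) f x + s * zetaOne a x * f x := by
  rw [spinH, hz, Matrix.cons_val_zero, spinD_frame hm hx, zeta_kerr hm hx]
  simp only [Matrix.cons_val]
  push_cast
  ring

theorem spinH_kerr_one (hm : 0 ≤ m) (hx : x ∈ patch m a) (k : ℕ) (s : ℝ) :
    spinH (kerr m a) (frame m a) k s 1 f x =
      along (frame m a 1) f x + (k * Complex.I * Lam a x + s * zetaTwo a x) * f x := by
  rw [spinH, hz, Matrix.cons_val_one, Matrix.cons_val_zero, spinD_frame hm hx, zeta_kerr hm hx]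
  simp only [Matrix.cons_val]
  ring

theorem spinDiv_kerr (hm : 0 ≤ m) (hx : x ∈ patch m a) :
    spinDiv (kerr m a) (frame m a) 2 f x =
      2 * (along (frame m a 0) f x - Complex.I * along (frame m a 1) f x + divCoeff a x * f x) := by
  rw [spinDiv, spinH_kerr_zero hm hx, spinH_kerr_one hm hx, divCoeff]
  push_cast
  linear_combination (-4 * (Lam a x : ℂ) * f x) * Complex.I_sq

theorem spinHat_kerr (hm : 0 ≤ m) (hx : x ∈ patch m a) :
    spinHat (kerr m a) (frame m a) 2 f x =
      along (frame m a 0) f x + Complex.I * along (frame m a 1) f x +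
        (2 * zetaOne a x - Lam a x + 2 * Complex.I * zetaTwo a x) * f x := by
  rw [spinHat, spinH_kerr_zero hm hx, spinH_kerr_one hm hx]
  push_cast
  linear_combination ((Lam a x : ℂ) * f x) * Complex.I_sq

theorem differentiableAt_along_frame (hx : x ∈ patch m a) (hf : ContDiffAt ℝ 2 f x) (i : Fin 4) :
    DifferentiableAt ℝ (along (frame m a i) f) x :=
  differentiableAt_along hf (differentiableAt_frame hx i)

theorem spin3_kerr_eventuallyEq (hm : 0 ≤ m) (hx : x ∈ patch m a) :
    spin3 (kerr m a) (frame m a) 2 f =ᶠ[𝓝 x] fun y =>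
      along (frame m a 2) f y + nablaThreeCoeff m a y * f y :=
  (eventually_mem_patch hx).mono fun _ hy => spin3_kerr hm hy

theorem spinDiv_kerr_eventuallyEq (hm : 0 ≤ m) (hx : x ∈ patch m a) :
    spinDiv (kerr m a) (frame m a) 2 f =ᶠ[𝓝 x] fun y =>
      2 * (along (frame m a 0) f y - Complex.I * along (frame m a 1) f y + divCoeff a y * f y) :=
  (eventually_mem_patch hx).mono fun _ hy => spinDiv_kerr hm hy

theorem differentiableAt_spin3 (hm : 0 ≤ m) (hx : x ∈ patch m a) (hf : ContDiffAt ℝ 2 f x) :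
    DifferentiableAt ℝ (spin3 (kerr m a) (frame m a) 2 f) x := by
  have df := hf.differentiableAt two_ne_zero
  have d2 := differentiableAt_along_frame hx hf 2
  have dc := differentiableAt_nablaThreeCoeff hx
  refine DifferentiableAt.congr_of_eventuallyEq ?_ (spin3_kerr_eventuallyEq hm hx)
  fun_prop

theorem differentiableAt_spinDiv (hm : 0 ≤ m) (hx : x ∈ patch m a) (hf : ContDiffAt ℝ 2 f x) :
    DifferentiableAt ℝ (spinDiv (kerr m a) (frame m a) 2 f) x := by
  have df := hf.differentiableAt two_ne_zero
  have d0 := differentiableAt_along_frame hx hf 0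
  have d1 := differentiableAt_along_frame hx hf 1
  have dc := differentiableAt_divCoeff hx
  refine DifferentiableAt.congr_of_eventuallyEq ?_ (spinDiv_kerr_eventuallyEq hm hx)
  fun_prop

theorem along_spin3 (hm : 0 ≤ m) (hx : x ∈ patch m a) (hf : ContDiffAt ℝ 2 f x) (X : VF) :
    along X (spin3 (kerr m a) (frame m a) 2 f) x =
      along X (along (frame m a 2) f) x + nablaThreeCoeff m a x * along X f x +
        along X (nablaThreeCoeff m a) x * f x := by
  have df := hf.differentiableAt two_ne_zero
  have d2 := differentiableAt_along_frame hx hf 2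
  have dc := differentiableAt_nablaThreeCoeff hx
  rw [along_congr (spin3_kerr_eventuallyEq hm hx), along_add X d2 (by fun_prop),
    along_mul X dc df]
  ring

theorem along_spinDiv (hm : 0 ≤ m) (hx : x ∈ patch m a) (hf : ContDiffAt ℝ 2 f x) (X : VF) :
    along X (spinDiv (kerr m a) (frame m a) 2 f) x =
      2 * (along X (along (frame m a 0) f) x - Complex.I * along X (along (frame m a 1) f) x
        + divCoeff a x * along X f x + along X (divCoeff a) x * f x) := by
  have df := hf.differentiableAt two_ne_zero
  have d0 := differentiableAt_along_frame hx hf 0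
  have d1 := differentiableAt_along_frame hx hf 1
  have dc := differentiableAt_divCoeff hx
  rw [along_congr (spinDiv_kerr_eventuallyEq hm hx), along_const_mul X 2 (by fun_prop),
    along_add X (by fun_prop) (by fun_prop), along_sub X d0 (by fun_prop),
    along_const_mul X _ d1, along_mul X dc df]
  ring

theorem spin4_spin3_kerr (hm : 0 ≤ m) (hx : x ∈ patch m a) (hf : ContDiffAt ℝ 2 f x) :
    spin4 (kerr m a) (frame m a) 1 (spin3 (kerr m a) (frame m a) 2 f) x =
      along (frame m a 3) (along (frame m a 2) f) x
      + 2 * Complex.I * twist a x * along (frame m a 2) f x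
      + nablaThreeCoeff m a x * along (frame m a 3) f x
      + (along (frame m a 3) (nablaThreeCoeff m a) x
        + 2 * Complex.I * twist a x * nablaThreeCoeff m a x) * f x := by
  rw [spin4_kerr hm hx, along_spin3 hm hx hf, spin3_kerr hm hx]
  ring

theorem spinHat_spinDiv_kerr (hm : 0 ≤ m) (hx : x ∈ patch m a) (hf : ContDiffAt ℝ 2 f x) :
    spinHat (kerr m a) (frame m a) 2 (spinDiv (kerr m a) (frame m a) 2 f) x =
      2 * (along (frame m a 0) (along (frame m a 0) f) x
        + along (frame m a 1) (along (frame m a 1) f) x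
        + (4 * zetaOne a x + Lam a x) * along (frame m a 0) f x
        + (4 * zetaTwo a x + 4 * Complex.I * Lam a x) * along (frame m a 1) f x
        - Complex.I * twist a x * along (frame m a 2) f x
        - Complex.I * (delRatio m a x * twist a x) * along (frame m a 3) f x
        + (along (frame m a 0) (divCoeff a) x
          + (2 * zetaOne a x - Lam a x + 2 * Complex.I * zetaTwo a x) * divCoeff a x) * f x) := by
  rw [spinHat_kerr hm hx, along_spinDiv hm hx hf, along_spinDiv hm hx hf, spinDiv_kerr hm hx,
    along_one_divCoeff hx, divCoeff]
  linear_combination (-2 * Complex.I) * along_frame_zero_one_comm hx hf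
    - (8 * zetaTwo a x * along (frame m a 1) f x
      + 2 * along (frame m a 1) (along (frame m a 1) f) x) * Complex.I_sq

theorem trX_kerr (hm : 0 ≤ m) (hx : x ∈ patch m a) :
    trX (kerr m a) (frame m a) x = 2 * (expansion a x - Complex.I * twist a x) := by
  rw [trX, trChi_kerr hm hx, atrChi_kerr hm hx]
  push_cast
  ring

theorem trXb_kerr (hm : 0 ≤ m) (hx : x ∈ patch m a) :
    trXb (kerr m a) (frame m a) x =
      -2 * delRatio m a x * (expansion a x + Complex.I * twist a x) := by
  rw [trXb, trChib_kerr hm hx, atrChib_kerr hm hx]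
  push_cast
  ring

theorem bigH_zero_kerr (hm : 0 ≤ m) (hx : x ∈ patch m a) :
    bigH (kerr m a) (frame m a) x 0 = -zetaOne a x + Complex.I * zetaTwo a x := by
  simp [bigH, eps, eta_kerr hm hx]

theorem bigHb_zero_kerr (hm : 0 ≤ m) (hx : x ∈ patch m a) :
    bigHb (kerr m a) (frame m a) x 0 = -zetaOne a x - Complex.I * zetaTwo a x := by
  simp [bigHb, eps, etab_kerr hm hx, sub_eq_add_neg]

theorem along_etab_zero_kerr (hm : 0 ≤ m) (hx : x ∈ patch m a) :
    along (frame m a 0) (etab (kerr m a) (frame m a) 0) x =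
      -along (frame m a 0) (zetaOne a) x := by
  have hU := hasGrad_zetaOne hx
  rw [along_congr ((eventually_mem_patch hx).mono fun y hy => etab_kerr hm hy 0)]
  refine (hU.neg.along_frame (m := m) (a := a) 0).trans ?_
  rw [hU.along_frame]
  exact smul_neg _ _

theorem potV_kerr (hm : 0 ≤ m) (hx : x ∈ patch m a) :
    potV m a x =
      4 * Lam a x ^ 2 - 2 * delRatio m a x * (expansion a x ^ 2 + 5 * twist a x ^ 2)
      - 20 * ombKerr m a x * expansion a x - 8 * rho (kerr m a) (frame m a) x
      - 2 * along (frame m a 0) (zetaOne a) x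
      + 6 * Lam a x * zetaOne a x + 8 * zetaOne a x ^ 2 - 16 * zetaTwo a x ^ 2
      + Complex.I * (4 * rhoDual (kerr m a) (frame m a) x - 20 * ombKerr m a x * twist a x
        - 12 * Lam a x * zetaTwo a x - 8 * zetaOne a x * zetaTwo a x) := by
  simp only [potV, potRe, potIm, trChi_kerr hm hx, atrChi_kerr hm hx, trChib_kerr hm hx,
    atrChib_kerr hm hx, omb_kerr hm hx, etab_kerr hm hx, along_etab_zero_kerr hm hx,
    Matrix.cons_val]
  push_cast
  ring

theorem waveRHS_kerr (hm : 0 ≤ m) (hx : x ∈ patch m a) :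
    waveRHS m a f x =
      (-4 * ombKerr m a x + 2 * Complex.I * (delRatio m a x * twist a x)) * along (frame m a 3) f x
      + (4 * expansion a x + 6 * Complex.I * twist a x) * along (frame m a 2) f x
      - 4 * Complex.I * zetaTwo a x * along (frame m a 0) f x
      - (8 * zetaTwo a x + 4 * Complex.I * (Lam a x + zetaOne a x)) * along (frame m a 1) f x
      + potV m a x * f x := by
  simp only [waveRHS, trChi_kerr hm hx, atrChi_kerr hm hx, atrChib_kerr hm hx, omb_kerr hm hx,
    etab_kerr hm hx, Matrix.cons_val]
  push_cast
  ring

theorem teukolskyScalar_kerr (hm : 0 ≤ m) (hx : x ∈ patch m a) (hf : ContDiffAt ℝ 2 f x) :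
    teukolskyScalar (kerr m a) (frame m a) f x = box (kerr m a) f x - waveRHS m a f x := by
  rw [teukolskyScalar, spin4_spin3_kerr hm hx hf, spinHat_spinDiv_kerr hm hx hf,
    box_kerr hm hx hf, waveRHS_kerr hm hx, potV_kerr hm hx, trX_kerr hm hx, trXb_kerr hm hx,
    bigH_zero_kerr hm hx, bigHb_zero_kerr hm hx, spin3_kerr hm hx, spin4_kerr hm hx,
    spinDiv_kerr hm hx, spinH_kerr_zero hm hx, spinH_kerr_one hm hx, etab_kerr hm hx,
    etab_kerr hm hx, along_three_nablaThreeCoeff hm hx, along_zero_divCoeff hm hx, curvP,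
    nablaThreeCoeff, divCoeff]
  simp only [map_add, map_sub, map_mul, map_neg, map_ofNat, Complex.conj_I, Complex.conj_ofReal,
    Matrix.cons_val]
  push_cast
  ring_nf
  simp only [Complex.I_sq]
  ring

theorem teukolskyOp_kerr {A : HTensor} (hm : 0 ≤ m) (hx : x ∈ patch m a)
    (hf : ContDiffAt ℝ 2 f x) (hA : ∀ᶠ y in 𝓝 x, ∀ b c, A y b c = f y * asdTensor b c)
    (b c : Fin 2) :
    teukolskyOp (kerr m a) (frame m a) A x b c =
      (box (kerr m a) f x - waveRHS m a f x) * asdTensor b c := by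
  have hconn_antisymm : ∀ᶠ y in 𝓝 x, ∀ X b c,
      hconn (kerr m a) (frame m a) X b c y = -hconn (kerr m a) (frame m a) X c b y :=
    (eventually_mem_patch hx).mono fun y hy X b c =>
      (isRigidFrameAt_kerr hm hy).ip_covD_antisymm X (hz b) (hz c)
  have differentiable : ∀ᶠ y in 𝓝 x, DifferentiableAt ℝ f y :=
    (hf.eventually (by simp)).mono fun y hy => hy.differentiableAt two_ne_zero
  rw [teukolskyOp_asd differentiable (differentiableAt_spin3 hm hx hf)
    (differentiableAt_spinDiv hm hx hf) hA hconn_antisymm, teukolskyScalar_kerr hm hx hf]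

end Wave

section NewmanPenrose

variable {m a : ℝ} {x : Pt} {f : Pt → ℂ}

/-- The phase `-q̄ / q` relating the tensorial and the Newman–Penrose components. -/
def phase (a : ℝ) (x : Pt) : ℂ := -((starRingEnd ℂ) (q a x) / q a x)

theorem conj_q (a : ℝ) (x : Pt) :
    (starRingEnd ℂ) (q a x) = (x 1 : ℂ) - Complex.I * ((a * Real.cos (x 2) : ℝ) : ℂ) := by
  simp only [q, map_add, map_mul, Complex.conj_ofReal, Complex.conj_I, neg_mul, sub_eq_add_neg]

theorem q_mul_conj (a : ℝ) (x : Pt) : q a x * (starRingEnd ℂ) (q a x) = qSq a x := by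
  rw [conj_q, q, qSq]
  push_cast
  linear_combination (-(a : ℂ) ^ 2 * Complex.cos (x 2) ^ 2) * Complex.I_sq

theorem q_ne_zero (hx : x ∈ patch m a) : q a x ≠ 0 := by
  refine left_ne_zero_of_mul (b := (starRingEnd ℂ) (q a x)) ?_
  rw [q_mul_conj]
  exact Complex.ofReal_ne_zero.2 (qSq_pos hx).ne'

theorem phase_ne_zero (hx : x ∈ patch m a) : phase a x ≠ 0 :=
  neg_ne_zero.2 (div_ne_zero ((map_ne_zero _).2 (q_ne_zero hx)) (q_ne_zero hx))

theorem contDiffAt_phase (hx : x ∈ patch m a) : ContDiffAt ℝ 2 (phase a) x := by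
  have contDiff_ofReal : ContDiff ℝ 2 ((↑) : ℝ → ℂ) := Complex.ofRealCLM.contDiff
  have contDiff_q : ContDiff ℝ 2 (q a) := by
    unfold q
    fun_prop
  unfold phase
  simp only [div_eq_mul_inv]
  exact ((Complex.conjCLE.contDiff.comp contDiff_q).contDiffAt.mul
    (contDiff_q.contDiffAt.inv (q_ne_zero hx))).neg

theorem hasGrad_q (a : ℝ) (x : Pt) :
    HasGrad (q a) 1 (-(Complex.I * ((a * Real.sin (x 2) : ℝ) : ℂ))) x := by
  have H := (HasGrad.r x).ofReal.add
    ((HasGrad.const Complex.I x).mul ((HasGrad.const a x).mul (HasGrad.cos x)).ofReal)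
  refine H.congr (fun _ => rfl) ?_ ?_ <;>
  · push_cast
    ring

theorem hasGrad_conj_q (a : ℝ) (x : Pt) :
    HasGrad (fun y => (starRingEnd ℂ) (q a y)) 1
      (Complex.I * ((a * Real.sin (x 2) : ℝ) : ℂ)) x := by
  have H := (HasGrad.r x).ofReal.sub
    ((HasGrad.const Complex.I x).mul ((HasGrad.const a x).mul (HasGrad.cos x)).ofReal)
  refine H.congr (conj_q a) ?_ ?_ <;>
  · push_cast
    ring

theorem hasGrad_phase (hx : x ∈ patch m a) :
    HasGrad (phase a) (2 * Complex.I * twist a x * phase a x)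
      (2 * Complex.I * (qAbs a x * zetaTwo a x) * phase a x) x := by
  have hq := q_ne_zero hx
  have hQ : (qAbs a x : ℂ) ≠ 0 := Complex.ofReal_ne_zero.2 (qAbs_pos hx).ne'
  have hQs : (qAbs a x : ℂ) ^ 2 = q a x * (starRingEnd ℂ) (q a x) := by
    rw [q_mul_conj, ← qAbs_sq hx, Complex.ofReal_pow]
  have twist_mul : (twist a x : ℂ) * (q a x * (starRingEnd ℂ) (q a x)) =
      ((a * Real.cos (x 2) : ℝ) : ℂ) := by
    rw [q_mul_conj, ← Complex.ofReal_mul, twist, div_mul_cancel₀ _ (qSq_pos hx).ne']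
  have zetaTwo_mul : (qAbs a x * zetaTwo a x : ℂ) * (q a x * (starRingEnd ℂ) (q a x)) =
      ((a * x 1 * Real.sin (x 2) : ℝ) : ℂ) := by
    rw [← hQs, zetaTwo]
    push_cast
    field_simp
  refine ((hasGrad_conj_q a x).div (hasGrad_q a x) hq).neg.congr (fun _ => rfl) ?_ ?_
  · rw [phase]
    field_simp
    rw [conj_q, q] at twist_mul ⊢
    linear_combination (2 * Complex.I) * twist_mul
  · rw [phase]
    field_simp
    rw [conj_q, q] at zetaTwo_mul ⊢
    push_cast at zetaTwo_mul ⊢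
    linear_combination 2 * zetaTwo_mul

theorem along_phase (hx : x ∈ patch m a) (i : Fin 4) :
    along (frame m a i) (phase a) x =
      ![2 * Complex.I * zetaTwo a x, 0, -2 * Complex.I * (delRatio m a x * twist a x),
        2 * Complex.I * twist a x] i * phase a x := by
  have hQ : (qAbs a x : ℂ) ≠ 0 := Complex.ofReal_ne_zero.2 (qAbs_pos hx).ne'
  rw [(hasGrad_phase hx).along_frame]
  fin_cases i <;>
    simp only [Matrix.cons_val, Complex.real_smul, Fin.reduceFinMk, Fin.zero_eta, Fin.mk_one] <;>
    push_cast
  · field_simp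
  · ring
  · ring

theorem along_three_twist (hx : x ∈ patch m a) :
    along (frame m a 3) (twist a) x = -2 * expansion a x * twist a x := by
  have hS := (qSq_pos hx).ne'
  refine ((hasGrad_twist hx).along_frame 3).trans ?_
  simp only [Matrix.cons_val, expansion, twist]
  field_simp

theorem along_phase_eventuallyEq (hx : x ∈ patch m a) (i : Fin 4) :
    along (frame m a i) (phase a) =ᶠ[𝓝 x] fun y =>
      ![2 * Complex.I * zetaTwo a y, 0, -2 * Complex.I * (delRatio m a y * twist a y),
        2 * Complex.I * twist a y] i * phase a y :=
  (eventually_mem_patch hx).mono fun _ hy => along_phase hy i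

theorem box_phase (hm : 0 ≤ m) (hx : x ∈ patch m a) :
    box (kerr m a) (phase a) x =
      (-4 * zetaTwo a x ^ 2 - 4 * delRatio m a x * twist a x ^ 2
        + 2 * Complex.I * (rhoDual (kerr m a) (frame m a) x - 2 * zetaOne a x * zetaTwo a x
          + 2 * expansion a x * delRatio m a x * twist a x)) * phase a x := by
  have dp := (hasGrad_phase hx).differentiableAt
  have dB := (hasGrad_twist hx).differentiableAt
  have dD := (hasGrad_delRatio hx).differentiableAt
  have dW := (hasGrad_zetaTwo hx).differentiableAt
  have along_delRatio : along (frame m a 3) (delRatio m a) x = 2 * ombKerr m a x :=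
    (hasGrad_delRatio hx).along_frame 3
  have dual := congrArg ((↑) : ℝ → ℂ) (rhoDual_kerr hm hx)
  rw [box_kerr hm hx (contDiffAt_phase hx)]
  simp only [along_congr (along_phase_eventuallyEq hx _), along_phase hx, Matrix.cons_val]
  rw [along_mul _ (by fun_prop) dp, along_mul _ (by fun_prop) dp, along_mul _ (by fun_prop) dp,
    along_const_mul _ _ (by fun_prop), along_const_mul _ _ (by fun_prop)]
  simp only [← Complex.ofReal_mul]
  rw [along_ofReal _ dW, along_ofReal _ (by fun_prop), along_mul _ dD dB, along_delRatio,
    along_zetaTwo hx, along_const]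
  simp only [along_phase hx, Matrix.cons_val]
  push_cast at dual ⊢
  linear_combination (-2 * Complex.I * phase a x) * dual
    + (4 * zetaTwo a x ^ 2 + 4 * delRatio m a x * twist a x ^ 2) * phase a x * Complex.I_sq

theorem box_phase_mul (hm : 0 ≤ m) (hx : x ∈ patch m a) (hf : ContDiffAt ℝ 2 f x) :
    box (kerr m a) (fun y => phase a y * f y) x =
      phase a x * box (kerr m a) f x + f x * box (kerr m a) (phase a) x +
      2 * Complex.I * phase a x * (2 * zetaTwo a x * along (frame m a 0) f x +
        delRatio m a x * twist a x * along (frame m a 3) f x -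
        twist a x * along (frame m a 2) f x) := by
  rw [(isRigidFrameAt_kerr hm hx).box_mul (contDiffAt_phase hx) hf, sum_nullGram_inv_smul]
  simp only [along_phase hx, Matrix.cons_val, Complex.real_smul]
  push_cast
  ring

theorem teukolsky_drift_re (hx : x ∈ patch m a) :
    qSq a x • (-ombKerr m a x • frame m a 3 x + expansion a x • frame m a 2 x
      - (2 * zetaTwo a x) • frame m a 1 x) =
    ![x 1 - m * (x 1 ^ 2 - a ^ 2) / Del m a x, m - x 1, 0, -(a * (x 1 - m) / Del m a x)] := by
  have hD := Del_ne_zero hx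
  have hQ := (qAbs_pos hx).ne'
  have hs := (sin_pos_of_mem_patch hx).ne'
  have hQs := (qAbs_sq hx).trans (qSq_eq_sin a x)
  ext l
  fin_cases l <;>
    simp only [frame, ombKerr, expansion, zetaTwo, ← qAbs_sq hx, Pi.add_apply, Pi.sub_apply,
      Pi.smul_apply, smul_eq_mul, Matrix.cons_val, Fin.reduceFinMk, Fin.zero_eta, Fin.mk_one] <;>
    field_simp
  · simp only [hQs, Del]
    ring
  · ring
  · ring
  · simp only [hQs, Del]
    ring

theorem teukolsky_drift_im (hx : x ∈ patch m a) :
    qSq a x • ((delRatio m a x * twist a x) • frame m a 3 x + twist a x • frame m a 2 x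
      - (Lam a x + zetaOne a x) • frame m a 1 x) =
    ![a * Real.cos (x 2), 0, 0, -(Real.cos (x 2) / Real.sin (x 2) ^ 2)] := by
  have hD := Del_ne_zero hx
  have hQ := (qAbs_pos hx).ne'
  have hs := (sin_pos_of_mem_patch hx).ne'
  have hQs := (qAbs_sq hx).trans (qSq_eq_sin a x)
  ext l
  fin_cases l <;>
    simp only [frame, delRatio, twist, zetaOne, Lam, Real.cot_eq_cos_div_sin, ← qAbs_sq hx,
      Pi.add_apply, Pi.sub_apply, Pi.smul_apply, smul_eq_mul, Matrix.cons_val, Fin.reduceFinMk,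
      Fin.zero_eta, Fin.mk_one] <;>
    field_simp
  · simp only [hQs]
    ring
  · ring
  · ring
  · simp only [hQs]
    ring

theorem teukolskyRHS_frame (hx : x ∈ patch m a) :
    teukolskyRHS m a f x =
      qSq a x * ((-4 * ombKerr m a x + 4 * Complex.I * (delRatio m a x * twist a x))
          * along (frame m a 3) f x
        + 4 * (expansion a x + Complex.I * twist a x) * along (frame m a 2) f x
        - (8 * zetaTwo a x + 4 * Complex.I * (Lam a x + zetaOne a x)) * along (frame m a 1) f x)
      + ((4 * Real.cot (x 2) ^ 2 - 2 : ℝ) : ℂ) * f x := by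
  have fderiv_apply (V : Fin 4 → ℝ) : fderiv ℝ f x V = ∑ μ, V μ • pd μ f x :=
    (along_eq_fderiv (fun _ => V) f x).symm
  have real_part := (congrArg (fderiv ℝ f x) (teukolsky_drift_re hx)).trans (fderiv_apply _)
  have imag_part := (congrArg (fderiv ℝ f x) (teukolsky_drift_im hx)).trans (fderiv_apply _)
  simp only [map_add, map_sub, map_smul, ← along_eq_fderiv, Complex.real_smul, Fin.sum_univ_four,
    Matrix.cons_val] at real_part imag_part
  rw [teukolskyRHS]
  push_cast at real_part imag_part ⊢
  linear_combination -4 * real_part - 4 * Complex.I * imag_part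

theorem qSq_mul_potential_eq (hm : 0 ≤ m) (hx : x ∈ patch m a) :
    qSq a x * (-20 * zetaTwo a x ^ 2 - 14 * delRatio m a x * twist a x ^ 2 + 4 * Lam a x ^ 2
      - 2 * delRatio m a x * expansion a x ^ 2 - 20 * expansion a x * ombKerr m a x
      - 8 * rho (kerr m a) (frame m a) x - 2 * along (frame m a 0) (zetaOne a) x
      + 6 * Lam a x * zetaOne a x + 8 * zetaOne a x ^ 2) = 4 * Real.cot (x 2) ^ 2 - 2 := by
  have hQ := (qAbs_pos hx).ne'
  have hs := (sin_pos_of_mem_patch hx).ne'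
  have hQc : qAbs a x ^ 2 = x 1 ^ 2 + a ^ 2 * Real.cos (x 2) ^ 2 := qAbs_sq hx
  rw [rho_kerr hm hx, (hasGrad_ombKerr hx).along_frame, (hasGrad_zetaOne hx).along_frame]
  simp only [zetaTwo, zetaOne, Lam, Real.cot_eq_cos_div_sin, delRatio, expansion, twist, ombKerr,
    Matrix.cons_val, smul_eq_mul, ← qAbs_sq hx]
  field_simp
  have hQc4 : qAbs a x ^ 4 = (x 1 ^ 2 + a ^ 2 * Real.cos (x 2) ^ 2) ^ 2 := by
    rw [← hQc]
    ring
  have hs4 : Real.sin (x 2) ^ 4 = (1 - Real.cos (x 2) ^ 2) ^ 2 := by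
    rw [← Real.sin_sq]
    ring
  simp only [hQc, hQc4, hs4, Real.sin_sq, Del]
  ring

theorem box_alphaOf_sub_teukolskyRHS (hm : 0 ≤ m) (hx : x ∈ patch m a) (hf : ContDiffAt ℝ 2 f x) :
    qSq a x * box (kerr m a) (alphaOf a f) x - teukolskyRHS m a (alphaOf a f) x =
      qSq a x * phase a x * (box (kerr m a) f x - waveRHS m a f x) := by
  have df := hf.differentiableAt two_ne_zero
  have dp := (hasGrad_phase hx).differentiableAt
  have alphaOf_eq : alphaOf a f = fun y => phase a y * f y := rfl
  have potential := congrArg ((↑) : ℝ → ℂ) (qSq_mul_potential_eq hm hx)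
  have dual := congrArg ((↑) : ℝ → ℂ) (rhoDual_kerr hm hx)
  rw [along_three_twist hx] at dual
  rw [alphaOf_eq, teukolskyRHS_frame hx, box_phase_mul hm hx hf, box_phase hm hx,
    waveRHS_kerr hm hx, potV_kerr hm hx]
  simp only [along_mul _ dp df, along_phase hx, Matrix.cons_val]
  push_cast at potential dual ⊢
  linear_combination phase a x * f x * potential + 6 * Complex.I * qSq a x * phase a x * f x * dual

end NewmanPenrose

section Weyl

variable {W : Fin 4 → Fin 4 → Fin 4 → Fin 4 → ℝ}

theorem sum_sum_comm_sum_sum {ι ι' κ κ' M : Type*} [Fintype ι] [Fintype ι'] [Fintype κ]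
    [Fintype κ'] [AddCommMonoid M]
    (S : ι → ι' → κ → κ' → M) :
    ∑ i, ∑ j, ∑ k, ∑ l, S i j k l = ∑ k, ∑ l, ∑ i, ∑ j, S i j k l := by
  rw [Finset.sum_congr rfl fun i _ => Finset.sum_comm, Finset.sum_comm]
  refine Finset.sum_congr rfl fun k _ => ?_
  rw [Finset.sum_congr rfl fun i _ => Finset.sum_comm, Finset.sum_comm]

theorem evalC_mul_add_I_mul (X Y Z T : Fin 4 → ℂ) (k : ℂ) :
    evalC W X (fun μ => k * (Y μ + Complex.I * Z μ)) T (fun μ => k * (Y μ + Complex.I * Z μ)) =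
      k ^ 2 * (evalC W X Y T Y - evalC W X Z T Z
        + Complex.I * (evalC W X Y T Z + evalC W X Z T Y)) := by
  simp only [evalC, mul_add, mul_sub, Finset.mul_sum, ← Finset.sum_add_distrib,
    ← Finset.sum_sub_distrib]
  refine Finset.sum_congr rfl fun α _ => Finset.sum_congr rfl fun β _ =>
    Finset.sum_congr rfl fun μ _ => Finset.sum_congr rfl fun ν _ => ?_
  linear_combination ((W α β μ ν : ℂ) * X α * T μ * k ^ 2 * Z β * Z ν) * Complex.I_sq

theorem evalC_pair_symm (h : ∀ α β μ ν, W α β μ ν = W μ ν α β) (X Y Z T : Fin 4 → ℂ) :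
    evalC W X Y Z T = evalC W Z T X Y := by
  rw [evalC, sum_sum_comm_sum_sum, evalC]
  refine Finset.sum_congr rfl fun μ _ => Finset.sum_congr rfl fun ν _ =>
    Finset.sum_congr rfl fun α _ => Finset.sum_congr rfl fun β _ => ?_
  rw [h α β μ ν]
  ring

theorem evalC_self_left (h : ∀ α β μ ν, W α β μ ν = -W β α μ ν) (X Z T : Fin 4 → ℂ) :
    evalC W X X Z T = 0 := by
  have eq_neg : evalC W X X Z T = -evalC W X X Z T := by
    conv_lhs => rw [evalC, Finset.sum_comm]
    simp only [evalC, ← Finset.sum_neg_distrib]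
    refine Finset.sum_congr rfl fun α _ => Finset.sum_congr rfl fun β _ =>
      Finset.sum_congr rfl fun μ _ => Finset.sum_congr rfl fun ν _ => ?_
    rw [h β α μ ν]
    push_cast
    ring
  exact self_eq_neg.1 eq_neg

theorem evalC_toC (X Z : Fin 4 → ℂ) (Y T : Fin 4 → ℝ) :
    evalC W X (toC Y) Z (toC T) =
      ∑ β, ∑ ν, (Y β * T ν) • ∑ α, ∑ μ, (W α β μ ν : ℂ) * X α * Z μ := by
  have sum_comm_inner (S : Fin 4 → Fin 4 → Fin 4 → Fin 4 → ℂ) :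
      ∑ α, ∑ β, ∑ μ, ∑ ν, S α β μ ν = ∑ β, ∑ ν, ∑ α, ∑ μ, S α β μ ν := by
    rw [Finset.sum_comm]
    refine Finset.sum_congr rfl fun β _ => ?_
    rw [Finset.sum_congr rfl fun α _ => Finset.sum_comm, Finset.sum_comm]
  rw [evalC, sum_comm_inner]
  simp only [Finset.smul_sum]
  refine Finset.sum_congr rfl fun β _ => Finset.sum_congr rfl fun ν _ =>
    Finset.sum_congr rfl fun α _ => Finset.sum_congr rfl fun μ _ => ?_
  rw [toC, toC, Complex.real_smul]
  push_cast
  ring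

theorem IsWeyl.trace_nullFrame {g : Metric} {e : Fin 4 → VF} {x : Pt} (hW : IsWeyl (g x) W)
    (hgram : ∀ i j, ip g (e i) (e j) x = nullGram i j) (X Z : Fin 4 → ℂ) :
    evalC W X (toC (e 0 x)) Z (toC (e 0 x)) + evalC W X (toC (e 1 x)) Z (toC (e 1 x))
      - (1 / 2 : ℝ) • (evalC W X (toC (e 2 x)) Z (toC (e 3 x))
        + evalC W X (toC (e 3 x)) Z (toC (e 2 x))) = 0 := by
  have trace := sum_inv_metric_smul isUnit_det_nullGram hgram
    fun β ν => ∑ α, ∑ μ, (W α β μ ν : ℂ) * X α * Z μ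
  simp only [← evalC_toC] at trace
  rw [← sum_nullGram_inv_smul fun i j => evalC W X (toC (e i x)) Z (toC (e j x)), ← trace]
  have trace_free (α μ : Fin 4) :
      ∑ β, ∑ ν, (g x)⁻¹ β ν • ((W α β μ ν : ℂ) * X α * Z μ) = 0 := by
    have cast_trace := congrArg ((↑) : ℝ → ℂ) (hW.trace_free α μ)
    push_cast at cast_trace
    simp only [Complex.real_smul, ← mul_assoc, ← Finset.sum_mul, cast_trace, zero_mul]
  simp only [Finset.smul_sum]
  rw [sum_sum_comm_sum_sum]
  exact Finset.sum_eq_zero fun α _ => Finset.sum_eq_zero fun μ _ => trace_free α μ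

theorem IsWeyl.evalC_nullFrame_one {g : Metric} {e : Fin 4 → VF} {x : Pt} (hW : IsWeyl (g x) W)
    (hgram : ∀ i j, ip g (e i) (e j) x = nullGram i j) :
    evalC W (toC (e 3 x)) (toC (e 1 x)) (toC (e 3 x)) (toC (e 1 x)) =
      -evalC W (toC (e 3 x)) (toC (e 0 x)) (toC (e 3 x)) (toC (e 0 x)) := by
  have trace := hW.trace_nullFrame hgram (toC (e 3 x)) (toC (e 3 x))
  rw [evalC_self_left hW.antisymm_left, evalC_pair_symm hW.pair_symm _ (toC (e 2 x)),
    evalC_self_left hW.antisymm_left, add_zero, smul_zero, sub_zero] at trace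
  exact eq_neg_of_add_eq_zero_right trace

theorem npM_coeff_sq {m a : ℝ} {x : Pt} (hx : x ∈ patch m a) :
    ((qAbs a x : ℂ) / ((√2 : ℝ) * q a x)) ^ 2 = -phase a x / 2 := by
  have hq := q_ne_zero hx
  have sqrt_two_sq : ((√2 : ℝ) : ℂ) ^ 2 = 2 := by
    rw [← Complex.ofReal_pow, Real.sq_sqrt zero_le_two, Complex.ofReal_ofNat]
  rw [div_pow, mul_pow, sqrt_two_sq, ← Complex.ofReal_pow, qAbs_sq hx, ← q_mul_conj, phase]
  field_simp

theorem alphaNP_eq {m a : ℝ} (hm : 0 ≤ m) {x : Pt} (hx : x ∈ patch m a)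
    (hW : IsWeyl (kerr m a x) W) :
    alphaNP m a W x = phase a x * nullA (frame m a) W x 0 0 := by
  have trace := hW.evalC_nullFrame_one (ip_frame hm hx)
  have pair_symm := evalC_pair_symm hW.pair_symm (toC (frame m a 3 x)) (toC (frame m a 0 x))
    (toC (frame m a 3 x)) (toC (frame m a 1 x))
  have expand := evalC_mul_add_I_mul (W := W) (toC (frame m a 3 x)) (toC (frame m a 0 x))
    (toC (frame m a 1 x)) (toC (frame m a 3 x)) ((qAbs a x : ℂ) / ((√2 : ℝ) * q a x))
  rw [npM_coeff_sq hx, trace, pair_symm] at expand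
  rw [alphaNP]
  refine (congrArg Neg.neg expand).trans ?_
  simp only [nullA, hz, Fin.sum_univ_two, eps, Matrix.cons_val]
  push_cast
  ring

end Weyl

end KerrTeukolsky

end

open KerrTeukolsky in
theorem mainTheorem7 (m a : ℝ) (hm : 0 ≤ m) (U : Set (Fin 4 → ℝ)) (hU : IsOpen U)
    (hUpatch : U ⊆ patch m a) (A : HTensor)
    (hA : ∀ x ∈ U, IsAntiSelfDual (A x))
    (hreg : ∀ b c : Fin 2, ContDiffOn ℝ 2 (fun x => A x b c) U) :
    (∀ x ∈ U, teukolskyOp (kerr m a) (frame m a) A x 0 0 =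
      box (kerr m a) (fun y => A y 0 0) x - waveRHS m a (fun y => A y 0 0) x) ∧
    ((∀ x ∈ U, ∀ b c : Fin 2, teukolskyOp (kerr m a) (frame m a) A x b c = 0) ↔
      ∀ x ∈ U, box (kerr m a) (fun y => A y 0 0) x = waveRHS m a (fun y => A y 0 0) x) ∧
    (∀ x ∈ U, box (kerr m a) (fun y => A y 0 0) x = waveRHS m a (fun y => A y 0 0) x ↔
      ((qSq a x : ℝ) : ℂ) * box (kerr m a) (alphaOf a (fun y => A y 0 0)) x =
        teukolskyRHS m a (alphaOf a (fun y => A y 0 0)) x) ∧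
    (∀ x ∈ U, ∀ W : Fin 4 → Fin 4 → Fin 4 → Fin 4 → ℝ, IsWeyl (kerr m a x) W →
      alphaNP m a W x =
        -((starRingEnd ℂ) (q a x) / q a x) * nullA (frame m a) W x 0 0) := by
  have hf : ∀ x ∈ U, ContDiffAt ℝ 2 (fun y => A y 0 0) x := fun x hx =>
    (hreg 0 0).contDiffAt (hU.mem_nhds hx)
  have op_eq : ∀ x ∈ U, ∀ b c, teukolskyOp (kerr m a) (frame m a) A x b c =
      (box (kerr m a) (fun y => A y 0 0) x - waveRHS m a (fun y => A y 0 0) x) *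
        asdTensor b c := fun x hx =>
    teukolskyOp_kerr hm (hUpatch hx) (hf x hx)
      ((hU.eventually_mem hx).mono fun y hy => (hA y hy).eq_mul_asdTensor)
  have op_zero_zero : ∀ x ∈ U, teukolskyOp (kerr m a) (frame m a) A x 0 0 =
      box (kerr m a) (fun y => A y 0 0) x - waveRHS m a (fun y => A y 0 0) x := fun x hx => by
    rw [op_eq x hx, asdTensor, asdForm_zero, mul_one, mul_one]
  refine ⟨op_zero_zero, ⟨fun h x hx => ?_, fun h x hx b c => ?_⟩, fun x hx => ?_,
    fun x hx W hW => alphaNP_eq hm (hUpatch hx) hW⟩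
  · rw [← sub_eq_zero, ← op_zero_zero x hx, h x hx 0 0]
  · rw [op_eq x hx, h x hx, sub_self, zero_mul]
  · have factor_ne_zero : (qSq a x : ℂ) * phase a x ≠ 0 :=
      mul_ne_zero (Complex.ofReal_ne_zero.2 (qSq_pos (hUpatch hx)).ne')
        (phase_ne_zero (hUpatch hx))
    rw [← sub_eq_zero, ← sub_eq_zero (a := _ * box _ _ _),
      box_alphaOf_sub_teukolskyRHS hm (hUpatch hx) (hf x hx), mul_eq_zero,
      or_iff_right factor_ne_zero]
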